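/- Let $G$ be a noncompact connected (real, finite-dimensional) Lie group with identity $e$, let $\lambda$ be a left Haar measure on $G$, and let $\delta$ be the modular function, $\lambda(Ay)=\delta(y)\lambda(A)$; let $\rho$ be the right Haar measure with $d\lambda=\delta\,d\rho$. Let $\mathbf X=\{X_1,\dots,X_\ell\}$ be linearly independent left-invariant vector fields on $G$ satisfying Hörmander's condition, let $d_C$ be the associated Carnot–Carathéodory distance, $B_r=\{x: d_C(x,e)<r\}$ and $V(r)=\lambda(B_r)$. Let $d\in\mathbb N$, $d\ge 1$, and $D>0$ be such that, for some $C_0>0$, $C_0^{-1}r^d\le V(r)\le C_0 r^d$ for $0<r\le 1$ and $V(r)\le C_0e^{Dr}$ for $r>1$; let $b>0$. For a continuous positive character $\chi$ of $G$ (a continuous homomorphism $G\to(0,\infty)$) let $\mu_\chi$ be the measure with density $\chi$ with respect to $\rho$ (so that $\mu_\delta=\lambda$), let $\Delta_\chi=-\sum_{j=1}^{\ell}\big(X_j^2+(X_j\chi)(e)X_j\big)$, which is essentially self-adjoint on $C_c^\infty(G)\subset L^2(\mu_\chi)$, and put $$\mathfrak c(\psi)=\Big(\sum_{j=1}^{\ell}|X_j\psi(e)|^2\Big)^{1/2},\qquad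 \tau_\chi=\max\Big\{\tfrac{2}{b}\big[\mathfrak c(\delta\chi^{-1})+2D+\tfrac{\sqrt b}{2}\big]^2-\tfrac14\mathfrak c(\chi)^2,\;1\Big\}.$$ For $1<p<\infty$ and $\alpha>0$, the operator $(\tau_\chi I+\Delta_\chi)^{-\alpha/2}$ of $L^2(\mu_\chi)$ extends from $L^2\cap L^p$ to a bounded injective operator on $L^p(\mu_\chi)$, whose inverse is denoted $(\tau_\chi I+\Delta_\chi)^{\alpha/2}$; $L^p_\alpha(\mu_\chi)$ is the domain of the latter, with the norm $\|f\|_{L^p_\alpha(\mu_\chi)}=\|(\tau_\chi I+\Delta_\chi)^{\alpha/2}f\|_{L^p(\mu_\chi)}$. All functions are complex-valued. **Claim.** The global Moser–Trudinger inequality fails for every $\mu_\chi\neq\lambda$: if there exist $p\in(1,\infty)$, $C>0$ and $\gamma>0$ such that, with $p'=p/(p-1)$, $$\int_G\Big(\exp\big(\gamma|f|^{p'}\big)-\sum_{0\le k<p-1}\frac{\gamma^k}{k!}|f|^{p'k}\Big)\,d\mu_\chi\le C\,\|f\|_{L^p(\mu_\chi)}^p$$ for all $f\in L^p_{d/p}(\mu_\chi)$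 with $\|f\|_{L^p_{d/p}(\mu_\chi)}\le 1$, then $\mu_\chi=\lambda$. -/

import Mathlib

open MeasureTheory Filter Topology
open scoped Manifold ContDiff ENNReal NNReal

noncomputable section

namespace SubLaplacian

/-- A smooth real Lie group is smooth enough to carry Mathlib's Lie bracket on its Lie algebra. -/
instance leInfty_minSmoothness : ENat.LEInfty (minSmoothness ℝ 3) :=
  ⟨by
    rw [minSmoothness_of_isRCLikeNormedField]
    exact ENat.LEInfty.out⟩

section Geometry

variable {E : Type*} [NormedAddCommGroup E] [NormedSpace ℝ E]
  {G : Type*} [TopologicalSpace G] [ChartedSpace E G] [Group G]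

/-- The derivative `X φ` of a function `φ` on `G` along the left-invariant vector field `X` whose
value at the identity is `v`. -/
def lieDeriv {F : Type*} [NormedAddCommGroup F] [NormedSpace ℝ F]
    (v : GroupLieAlgebra 𝓘(ℝ, E) G) (φ : G → F) (x : G) : F :=
  mfderiv 𝓘(ℝ, E) 𝓘(ℝ, F) φ x (mulInvariantVectorField v x)

/-- Hörmander's condition for a family of left-invariant vector fields: together with their
iterated brackets they span the whole Lie algebra. -/
def IsHormander [FiniteDimensional ℝ E] [LieGroup 𝓘(ℝ, E) ∞ G] {l : ℕ}
    (X : Fin l → GroupLieAlgebra 𝓘(ℝ, E) G) : Prop :=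
  haveI : CompleteSpace E := FiniteDimensional.complete ℝ E
  LieSubalgebra.lieSpan ℝ (GroupLieAlgebra 𝓘(ℝ, E) G) (Set.range X) = ⊤

/-- `γ : [0,1] → G` is a horizontal (absolutely continuous) curve from `x` to `y`, with
`γ' = ∑ j, a j • X j (γ)` almost everywhere and `a j ∈ L¹(0,1)`; the differential equation is
written in integrated form against all smooth functions. -/
structure IsHorizontalCurve {l : ℕ} (X : Fin l → GroupLieAlgebra 𝓘(ℝ, E) G) (x y : G)
    (γ : ℝ → G) (a : Fin l → ℝ → ℝ) : Prop where
  continuousOn : ContinuousOn γ (Set.Icc 0 1)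
  source : γ 0 = x
  target : γ 1 = y
  integrable : ∀ j, IntervalIntegrable (a j) volume 0 1
  deriv_eq : ∀ φ : G → ℝ, ContMDiff 𝓘(ℝ, E) 𝓘(ℝ, ℝ) ∞ φ → ∀ t ∈ Set.Icc (0 : ℝ) 1,
    φ (γ t) - φ x = ∫ s in (0 : ℝ)..t, ∑ j, a j s * lieDeriv (X j) φ (γ s)

/-- The Carnot–Carathéodory distance: the infimum of the lengths `∫₀¹ (∑ j, a j ^ 2) ^ (1/2)` of
the horizontal curves from `x` to `y` (with value `⊤` if there is none). -/
def ccDist {l : ℕ} (X : Fin l → GroupLieAlgebra 𝓘(ℝ, E) G) (x y : G) : ℝ≥0∞ :=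
  ⨅ (γ : ℝ → G) (a : Fin l → ℝ → ℝ) (_ : IsHorizontalCurve X x y γ a),
    ENNReal.ofReal (∫ s in (0 : ℝ)..1, Real.sqrt (∑ j, a j s ^ 2))

/-- The ball `B_r` of radius `r` centred at the identity. -/
def ccBall {l : ℕ} (X : Fin l → GroupLieAlgebra 𝓘(ℝ, E) G) (r : ℝ) : Set G :=
  {x | ccDist X x 1 < ENNReal.ofReal r}

/-- `d` is the local dimension and `D` a bound for the exponential growth rate:
`C⁻¹ r ^ d ≤ V(r) ≤ C r ^ d` for `0 < r ≤ 1` and `V(r) ≤ C e ^ (D r)` for `r > 1`, where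
`V(r) = lam (B_r)`. -/
def HasVolumeGrowth [MeasurableSpace G] {l : ℕ} (X : Fin l → GroupLieAlgebra 𝓘(ℝ, E) G)
    (lam : Measure G) (d : ℕ) (D : ℝ) : Prop :=
  ∃ C : ℝ, 0 < C ∧
    (∀ r : ℝ, 0 < r → r ≤ 1 →
      ENNReal.ofReal (C⁻¹ * r ^ d) ≤ lam (ccBall X r) ∧
      lam (ccBall X r) ≤ ENNReal.ofReal (C * r ^ d)) ∧
    ∀ r : ℝ, 1 < r → lam (ccBall X r) ≤ ENNReal.ofReal (C * Real.exp (D * r))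

/-- `𝔠(χ) = (∑ j, |X_j χ (e)| ^ 2) ^ (1/2)`. -/
def charNorm {l : ℕ} (X : Fin l → GroupLieAlgebra 𝓘(ℝ, E) G) (χ : G → ℝ) : ℝ :=
  Real.sqrt (∑ j, |lieDeriv (X j) χ 1| ^ 2)

/-- The sub-Laplacian with drift `Δ_χ φ = -∑ j, (X_j² φ + (X_j χ)(e) X_j φ)`. -/
def driftLaplacian {l : ℕ} (X : Fin l → GroupLieAlgebra 𝓘(ℝ, E) G) (χ : G → ℝ) (φ : G → ℂ)
    (x : G) : ℂ :=
  -∑ j, (lieDeriv (X j) (lieDeriv (X j) φ) x + lieDeriv (X j) χ 1 • lieDeriv (X j) φ x)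

end Geometry

section Measures

variable {G : Type*} [TopologicalSpace G] [Group G] [IsTopologicalGroup G] [LocallyCompactSpace G]

/-- The modular function `δ` with `lam (A y) = δ y * lam A` for a left Haar measure `lam`
(Mathlib's `modularCharacter` is the inverse: `lam (A y⁻¹) = modularCharacter y * lam A`). -/
def modularFun (y : G) : ℝ := (Measure.modularCharacter y⁻¹ : ℝ≥0)

/-- The right Haar measure `ρ` with `d lam = δ dρ`. -/
def rightHaar [MeasurableSpace G] (lam : Measure G) : Measure G :=
  lam.withDensity fun x => ENNReal.ofReal (modularFun x)⁻¹

/-- The measure `μ_χ` with density `χ` with respect to `ρ`. -/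
def muChi [MeasurableSpace G] (lam : Measure G) (χ : G → ℝ) : Measure G :=
  (rightHaar lam).withDensity fun x => ENNReal.ofReal (χ x)

end Measures

/-- The power `R ^ s`, `s > 0`, of a nonnegative bounded self-adjoint operator on a complex Hilbert
space, by the continuous functional calculus. -/
def opPow {H : Type*} [NormedAddCommGroup H] [InnerProductSpace ℂ H] [CompleteSpace H]
    (R : H →L[ℂ] H) (s : ℝ) : H →L[ℂ] H :=
  cfc (fun r : ℝ => r ^ s) R

section Sobolev

variable {E : Type*} [NormedAddCommGroup E] [NormedSpace ℝ E]
  {G : Type*} [TopologicalSpace G] [ChartedSpace E G] [Group G]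

/-- The shift `τ_χ = max {(2/b) (𝔠(δ χ⁻¹) + 2 D + √b / 2)² - 𝔠(χ)² / 4, 1}`. -/
def shift [IsTopologicalGroup G] [LocallyCompactSpace G] {l : ℕ}
    (X : Fin l → GroupLieAlgebra 𝓘(ℝ, E) G) (χ : G → ℝ) (b D : ℝ) : ℝ :=
  max (2 / b * (charNorm X (fun x => modularFun x * (χ x)⁻¹) + 2 * D + Real.sqrt b / 2) ^ 2
    - 1 / 4 * charNorm X χ ^ 2) 1

variable [MeasurableSpace G]

/-- `R = (τ I + Δ_χ)⁻¹` on `L²(μ)`, where `Δ_χ` is the self-adjoint extension of the sub-Laplacian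
with drift initially defined on `C_c^∞(G)`: a bounded self-adjoint operator on `L²(μ)` with
`R (τ φ + Δ_χ φ) = φ` for every test function `φ`. (The range of such an `R` is dense, so `R` is
injective and `R⁻¹ - τ` is a self-adjoint extension of `Δ_χ` from `C_c^∞(G)`; for `μ = μ_χ` there is
exactly one, as `Δ_χ` is essentially self-adjoint there.) -/
structure IsResolvent {l : ℕ} (X : Fin l → GroupLieAlgebra 𝓘(ℝ, E) G) (χ : G → ℝ) (μ : Measure G)
    (τ : ℝ) (R : Lp ℂ 2 μ →L[ℂ] Lp ℂ 2 μ) : Prop where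
  selfAdjoint : IsSelfAdjoint R
  leftInverse : ∀ φ : G → ℂ, ContMDiff 𝓘(ℝ, E) 𝓘(ℝ, ℂ) ∞ φ → HasCompactSupport φ →
    ∀ u w : Lp ℂ 2 μ, u =ᵐ[μ] φ → w =ᵐ[μ] (fun x => τ * φ x + driftLaplacian X χ φ x) → R w = u

/-- `f` lies in the domain of `(τ I + Δ_χ) ^ s` in `L^p(μ)`, and `(τ I + Δ_χ) ^ s f = g`; that is,
`f, g ∈ L^p(μ)` and `f = (τ I + Δ_χ) ^ (-s) g`.
On `L²(μ)` the operator `(τ I + Δ_χ) ^ (-s)` is the power `R ^ s` of the resolvent `R`; on `L^p(μ)` it is the continuous extension of its restriction to `L² ∩ L^p`,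
so its graph is the closure in `L^p × L^p` of the pairs `(v, R ^ s v)`. -/
def IsFracPower {l : ℕ} (X : Fin l → GroupLieAlgebra 𝓘(ℝ, E) G) (χ : G → ℝ) (μ : Measure G)
    (τ s : ℝ) (p : ℝ≥0∞) (f g : G → ℂ) : Prop :=
  MemLp f p μ ∧ MemLp g p μ ∧
  ∃ R : Lp ℂ 2 μ →L[ℂ] Lp ℂ 2 μ, IsResolvent X χ μ τ R ∧
  ∃ v : ℕ → Lp ℂ 2 μ,
    Tendsto (fun n => eLpNorm (fun x => v n x - g x) p μ) atTop (𝓝 0) ∧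
    Tendsto (fun n => eLpNorm (fun x => opPow R s (v n) x - f x) p μ) atTop (𝓝 0)

/-- The Sobolev norm `‖f‖_{L^p_α(μ)} = ‖(τ I + Δ_χ) ^ (α/2) f‖_{L^p(μ)}`. It is `⊤` if `f` is not in
the domain of `(τ I + Δ_χ) ^ (α/2)` in `L^p(μ)`, so that `L^p_α(μ)` is the set of all `f` of finite
norm. (The infimum is over the single class `g = (τ I + Δ_χ) ^ (α/2) f`.) -/
def sobolevNorm {l : ℕ} (X : Fin l → GroupLieAlgebra 𝓘(ℝ, E) G) (χ : G → ℝ) (μ : Measure G)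
    (τ α p : ℝ) (f : G → ℂ) : ℝ≥0∞ :=
  ⨅ (g : G → ℂ) (_ : IsFracPower X χ μ τ (α / 2) (ENNReal.ofReal p) f g),
    eLpNorm g (ENNReal.ofReal p) μ

/-- The global Moser–Trudinger inequality on `L^p_α(μ)` with constants `γ` and `C`:
`∫ (exp (γ |f| ^ p') - ∑_{0 ≤ k < p - 1} γ ^ k / k! |f| ^ (p' k)) dμ ≤ C ‖f‖_p ^ p`, `p' = p / (p-1)`,
for all `f` with `‖f‖_{L^p_α(μ)} ≤ 1`. The integrand is nonnegative. -/
def GlobalMoserTrudinger {l : ℕ} (X : Fin l → GroupLieAlgebra 𝓘(ℝ, E) G) (χ : G → ℝ)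
    (μ : Measure G) (τ α p γ C : ℝ) : Prop :=
  ∀ f : G → ℂ, sobolevNorm X χ μ τ α p f ≤ 1 →
    ∫⁻ x, ENNReal.ofReal (Real.exp (γ * ‖f x‖ ^ (p / (p - 1))) -
        ∑ k ∈ Finset.range ⌈p - 1⌉₊,
          γ ^ k / (Nat.factorial k : ℝ) * ‖f x‖ ^ (p / (p - 1) * (k : ℝ))) ∂μ
      ≤ ENNReal.ofReal C * eLpNorm f (ENNReal.ofReal p) μ ^ p

end Sobolev

end SubLaplacian

end

/-!
Why a Moser–Trudinger inequality forces `μ_χ = lam`.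

Let `ψ = χ δ⁻¹` (`leftDensity`), a continuous character, so that `μ_χ = ψ lam`. The translation
`x ↦ z⁻¹ x` multiplies `μ_χ` by the factor `m = ψ(z)` (`map_mul_left_muChi`), while `Δ_χ`, being
built from left-invariant vector fields, commutes with it (`IsFracPower.translate`). Hence for
`f = (τ + Δ_χ) ^ (-α/2) g` the functions `m ^ (-1/p) f(z⁻¹ x)` have the same `L^p` norm and the same
bound on the Sobolev norm for every `z`. The integrand of the inequality dominates a multiple of
`|f| ^ q` for some `q > p` (`le_moserTrudinger_integrand`), and the integral of the `q`-th power of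
the normalised translate is `m ^ (1 - q/p) ∫ |f| ^ q`. If `ψ` is not constant, then `m` can be
made arbitrarily small, and the left-hand side of the inequality is unbounded while its right-hand
side is fixed (`GlobalMoserTrudinger.false_of_contracting`). So `ψ = 1`.

This needs one pair `f ≠ 0`, `g` as above, for the exponent `p` at hand
(`exists_isFracPower_ne_zero`). With a test function `φ` and an integer `k > α/2`, take
`g = (τ + Δ_χ) ^ k φ`, which is again a test function; `f = R ^ (α/2) g` is not zero in `L²`,
where `R = (τ + Δ_χ)⁻¹`, because `R ^ k g = φ`. That `f ∈ L^p` follows from bounds on `L¹` and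
`L^∞`:

* Every left-invariant field `X` satisfies `∫ X φ dμ_χ = -(X χ)(e) ∫ φ dμ_χ`
  (`integral_lieDeriv`), so `Δ_χ` is the operator of the form `∑ j, ⟨X_j ψ, X_j φ⟩`, and
  `R` is constructed from the closure of the graph of the horizontal gradient
  (`exists_form_resolvent`).
* Testing the weak equation for `z = R y` with a truncation of `z` gives the `L^∞` bounds of `R` and
  of `R (t + R)⁻¹`, `t > 0` (`re_inner_softTrunc_nonneg`, `ae_norm_le_of_re_inner_softTrunc`). As
  `R ^ s`, `0 < s < 1`, is a positive average of the latter operators (`norm_inner_opPow_le`), all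
  powers `R ^ s` are contractions for the `L^∞` norm (`isLinftyContraction_opPow`).
* `R ^ s` is self-adjoint, so by duality it maps `L¹ ∩ L²` into `L¹`
  (`IsLinftyContraction.integrable`).
-/

noncomputable section

namespace SubLaplacian

/-! ### Left-invariant differentiation in a chart -/

section Calculus

variable {E : Type*} [NormedAddCommGroup E] [NormedSpace ℝ E]
  {G : Type*} [TopologicalSpace G] [ChartedSpace E G] [Group G] [LieGroup 𝓘(ℝ, E) ∞ G]
  {F : Type*} [NormedAddCommGroup F] [NormedSpace ℝ F]

variable (E G) in
/-- The parametrisation of a neighbourhood of the identity by the preferred chart, centred so that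
`0 : E` is sent to `1`. Its values away from the translated target of the chart are junk. -/
def chartParam (w : E) : G :=
  (extChartAt 𝓘(ℝ, E) (1 : G)).symm (extChartAt 𝓘(ℝ, E) (1 : G) 1 + w)

variable (E G) in
/-- A vector of the Lie algebra, the tangent space at the identity, as a vector of the model
space. -/
def algVec (v : GroupLieAlgebra 𝓘(ℝ, E) G) : E := v

omit [LieGroup 𝓘(ℝ, E) ∞ G] in
@[simp] lemma chartParam_zero : chartParam E G 0 = 1 := by
  simp [chartParam]

variable (E G) in
lemma eventually_contMDiffAt_chartParam :
    ∀ᶠ w in 𝓝 (0 : E), ContMDiffAt 𝓘(ℝ, E) 𝓘(ℝ, E) ∞ (chartParam E G) w := by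
  have h1 : (extChartAt 𝓘(ℝ, E) (1 : G)).target ∈ 𝓝 (extChartAt 𝓘(ℝ, E) (1 : G) 1 + 0) := by
    rw [add_zero]; exact extChartAt_target_mem_nhds _
  have h2 : Tendsto (fun w : E => extChartAt 𝓘(ℝ, E) (1 : G) 1 + w) (𝓝 0)
      (𝓝 (extChartAt 𝓘(ℝ, E) (1 : G) 1 + 0)) := (continuous_const.add continuous_id).tendsto 0
  filter_upwards [h2 h1] with w hw
  have h3 : ContMDiffAt 𝓘(ℝ, E) 𝓘(ℝ, E) ∞ (extChartAt 𝓘(ℝ, E) (1 : G)).symm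
      (extChartAt 𝓘(ℝ, E) (1 : G) 1 + w) :=
    (contMDiffOn_extChartAt_symm (1 : G)).contMDiffAt
      ((isOpen_extChartAt_target (I := 𝓘(ℝ, E)) (1 : G)).mem_nhds hw)
  have h4 : ContMDiffAt 𝓘(ℝ, E) 𝓘(ℝ, E) ∞ (fun w : E => extChartAt 𝓘(ℝ, E) (1 : G) 1 + w) w :=
    (contDiff_const.add contDiff_id).contMDiff.contMDiffAt
  exact h3.comp w h4

lemma contMDiffAt_chartParam_zero :
    ContMDiffAt 𝓘(ℝ, E) 𝓘(ℝ, E) ∞ (chartParam E G) 0 :=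
  (eventually_contMDiffAt_chartParam E G).self_of_nhds

/-- The identification of the tangent space at `1` with the model space is the one given by
`chartParam`. -/
lemma hasMFDerivAt_chartParam :
    HasMFDerivAt 𝓘(ℝ, E) 𝓘(ℝ, E) (chartParam E G) 0
      (ContinuousLinearMap.id ℝ E : TangentSpace 𝓘(ℝ, E) (0 : E) →L[ℝ]
        TangentSpace 𝓘(ℝ, E) (chartParam E G 0)) := by
  refine ⟨contMDiffAt_chartParam_zero.continuousAt, ?_⟩
  have h1 : (extChartAt 𝓘(ℝ, E) (1 : G)).target ∈ 𝓝 (extChartAt 𝓘(ℝ, E) (1 : G) 1 + 0) := by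
    rw [add_zero]; exact extChartAt_target_mem_nhds _
  have h2 : Tendsto (fun w : E => extChartAt 𝓘(ℝ, E) (1 : G) 1 + w) (𝓝 0)
      (𝓝 (extChartAt 𝓘(ℝ, E) (1 : G) 1 + 0)) := (continuous_const.add continuous_id).tendsto 0
  have h3 : HasFDerivAt (fun w : E => extChartAt 𝓘(ℝ, E) (1 : G) 1 + w)
      (ContinuousLinearMap.id ℝ E) 0 := (hasFDerivAt_id 0).const_add _
  refine HasFDerivAt.hasFDerivWithinAt (h3.congr_of_eventuallyEq ?_)
  filter_upwards [h2 h1] with w hw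
  simp only [writtenInExtChartAt, extChartAt_model_space_eq_id, chartParam_zero]
  exact (extChartAt 𝓘(ℝ, E) (1 : G)).right_inv hw

lemma differentiableAt_mul_chartParam {φ : G → F} (hφ : ContMDiff 𝓘(ℝ, E) 𝓘(ℝ, F) ∞ φ) {w : E}
    (hw : ContMDiffAt 𝓘(ℝ, E) 𝓘(ℝ, E) ∞ (chartParam E G) w) (x : G) :
    DifferentiableAt ℝ (fun w => φ (x * chartParam E G w)) w := by
  have : ContMDiffAt 𝓘(ℝ, E) 𝓘(ℝ, F) ∞ (fun w : E => φ (x * chartParam E G w)) w :=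
    hφ.contMDiffAt.comp w (contMDiffAt_const.mul hw)
  exact this.contDiffAt.differentiableAt (by simp)

/-- A left-invariant derivative at `x` is the derivative in the direction `v` of `w ↦ φ (x w)` in
the chart at the identity. This reduces the calculus of `lieDeriv` to that of `fderiv`. -/
lemma lieDeriv_eq_fderiv_of_mdifferentiableAt (v : GroupLieAlgebra 𝓘(ℝ, E) G) {φ : G → F} {x : G}
    (hφ : MDifferentiableAt 𝓘(ℝ, E) 𝓘(ℝ, F) φ x) :
    lieDeriv v φ x = fderiv ℝ (fun w : E => φ (x * chartParam E G w)) 0 (algVec E G v) := by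
  have h1 : HasMFDerivAt 𝓘(ℝ, E) 𝓘(ℝ, E) (fun a : G => x * a) (chartParam E G 0)
      (mfderiv 𝓘(ℝ, E) 𝓘(ℝ, E) (fun a : G => x * a) (chartParam E G 0)) :=
    (contMDiff_mul_left.contMDiffAt (n := ∞)|>.mdifferentiableAt (by simp)).hasMFDerivAt
  have h2 : HasMFDerivAt 𝓘(ℝ, E) 𝓘(ℝ, F) φ (x * chartParam E G 0)
      (mfderiv 𝓘(ℝ, E) 𝓘(ℝ, F) φ (x * chartParam E G 0)) :=
    MDifferentiableAt.hasMFDerivAt (by rwa [chartParam_zero, mul_one])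
  have h3 := (h2.comp _ h1).comp _ hasMFDerivAt_chartParam
  have h4 : fderiv ℝ ((φ ∘ fun a => x * a) ∘ chartParam E G) 0 =
      (((mfderiv 𝓘(ℝ, E) 𝓘(ℝ, F) φ (x * chartParam E G 0) : E →L[ℝ] F).comp
        (mfderiv 𝓘(ℝ, E) 𝓘(ℝ, E) (fun a : G => x * a) (chartParam E G 0) : E →L[ℝ] E)).comp
          (ContinuousLinearMap.id ℝ E)) := HasFDerivAt.fderiv (hasMFDerivAt_iff_hasFDerivAt.1 h3)
  have h5 : (fun w : E => φ (x * chartParam E G w)) = ((φ ∘ fun a => x * a) ∘ chartParam E G) := rfl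
  have h6 := congrArg (fun L : E →L[ℝ] F => L (algVec E G v)) h4
  rw [h5]
  refine Eq.trans ?_ h6.symm
  have h7 : ∀ z : G, z = 1 → lieDeriv v φ x = (mfderiv 𝓘(ℝ, E) 𝓘(ℝ, F) φ (x * z))
     ((mfderiv 𝓘(ℝ, E) 𝓘(ℝ, E) (fun a : G => x * a) z) (algVec E G v)) := by
    rintro z rfl
    have h8 : ∀ u : G, u = x → lieDeriv v φ x = (mfderiv 𝓘(ℝ, E) 𝓘(ℝ, F) φ u)
       ((mfderiv 𝓘(ℝ, E) 𝓘(ℝ, E) (fun a : G => x * a) 1) (algVec E G v)) := by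
      rintro u rfl; rfl
    exact h8 _ (mul_one x)
  exact h7 _ chartParam_zero

lemma lieDeriv_eq_fderiv (v : GroupLieAlgebra 𝓘(ℝ, E) G) {φ : G → F}
    (hφ : ContMDiff 𝓘(ℝ, E) 𝓘(ℝ, F) ∞ φ) (x : G) :
    lieDeriv v φ x = fderiv ℝ (fun w : E => φ (x * chartParam E G w)) 0 (algVec E G v) :=
  lieDeriv_eq_fderiv_of_mdifferentiableAt v (hφ.contMDiffAt.mdifferentiableAt (by simp))

lemma hasDerivAt_lieDeriv (v : GroupLieAlgebra 𝓘(ℝ, E) G) {φ : G → F}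
    (hφ : ContMDiff 𝓘(ℝ, E) 𝓘(ℝ, F) ∞ φ) (x : G) :
    HasDerivAt (fun t : ℝ => φ (x * chartParam E G (t • algVec E G v))) (lieDeriv v φ x) 0 := by
  have h1 := (differentiableAt_mul_chartParam hφ contMDiffAt_chartParam_zero x).hasFDerivAt
  rw [lieDeriv_eq_fderiv v hφ]
  have h2 : HasDerivAt (fun t : ℝ => t • algVec E G v) (algVec E G v) 0 := by
    simpa using (hasDerivAt_id (0:ℝ)).smul_const (algVec E G v)
  have h1' : HasFDerivAt (fun w => φ (x * chartParam E G w))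
    (fderiv ℝ (fun w : E => φ (x * chartParam E G w)) 0) ((0:ℝ) • algVec E G v) := by
    rw [zero_smul]; exact h1
  exact h1'.comp_hasDerivAt (0:ℝ) h2

/-- Smooth dependence on `x` of the derivative of `w ↦ φ (x w)`. -/
lemma contMDiffAt_fderiv_chartParam {φ : G → F} (hφ : ContMDiff 𝓘(ℝ, E) 𝓘(ℝ, F) ∞ φ) {w : E}
    (hw : ContMDiffAt 𝓘(ℝ, E) 𝓘(ℝ, E) ∞ (chartParam E G) w) (x : G) :
    ContMDiffAt (𝓘(ℝ, E).prod 𝓘(ℝ, E)) 𝓘(ℝ, E →L[ℝ] F) ∞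
      (fun q : G × E => fderiv ℝ (fun w => φ (q.1 * chartParam E G w)) q.2) (x, w) := by
  have h := ContMDiffAt.mfderiv (I := 𝓘(ℝ, E)) (I' := 𝓘(ℝ, F)) (J := 𝓘(ℝ, E).prod 𝓘(ℝ, E)) (m := ∞)
    (n := ∞) (x₀ := ((x, w) : G × E))
    (fun (q : G × E) (w : E) => φ (q.1 * chartParam E G w)) (fun q => q.2) ?_ contMDiffAt_snd
    (by simp)
  · refine h.congr_of_eventuallyEq (Eventually.of_forall fun q => ?_)
    refine Eq.trans ?_ (congrFun (inTangentCoordinates_model_space (I := 𝓘(ℝ, E)) (I' := 𝓘(ℝ, F))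
      (fun q : G × E => q.2) (fun q => φ (q.1 * chartParam E G q.2)) (fun q => mfderiv 𝓘(ℝ, E)
        𝓘(ℝ, F) (fun w => φ (q.1 * chartParam E G w)) q.2) (x, w)) q).symm
    exact mfderiv_eq_fderiv.symm
  · refine hφ.contMDiffAt.comp _ ?_
    have h3 : ContMDiffAt ((𝓘(ℝ, E).prod 𝓘(ℝ, E)).prod 𝓘(ℝ, E)) 𝓘(ℝ, E) ∞
      (fun q : (G × E) × E => q.1.1) ((x, w), w) := contMDiffAt_fst.comp _ contMDiffAt_fst
    exact h3.mul (ContMDiffAt.comp (g := chartParam E G) ((x, w), w) hw contMDiffAt_snd)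

lemma contMDiff_lieDeriv (v : GroupLieAlgebra 𝓘(ℝ, E) G) {φ : G → F}
    (hφ : ContMDiff 𝓘(ℝ, E) 𝓘(ℝ, F) ∞ φ) : ContMDiff 𝓘(ℝ, E) 𝓘(ℝ, F) ∞ (lieDeriv v φ) := by
  intro x
  have h1 := (contMDiffAt_fderiv_chartParam hφ (contMDiffAt_chartParam_zero) x).comp x
    (contMDiffAt_id.prodMk (contMDiffAt_const (c := (0 : E))))
  have h2 : ContMDiffAt 𝓘(ℝ, E) 𝓘(ℝ, F) ∞
      (fun x => fderiv ℝ (fun w : E => φ (x * chartParam E G w)) 0 (algVec E G v)) x :=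
    h1.clm_apply contMDiffAt_const
  exact h2.congr_of_eventuallyEq (Eventually.of_forall fun y => lieDeriv_eq_fderiv v hφ y)

lemma lieDeriv_comp_mul_left (v : GroupLieAlgebra 𝓘(ℝ, E) G) {φ : G → F}
    (hφ : ContMDiff 𝓘(ℝ, E) 𝓘(ℝ, F) ∞ φ) (y : G) :
    lieDeriv v (fun x => φ (y * x)) = fun x => lieDeriv v φ (y * x) := by
  ext x
  rw [lieDeriv_eq_fderiv v hφ]
  refine (lieDeriv_eq_fderiv v (hφ.comp contMDiff_mul_left) x).trans ?_
  simp only [Function.comp_def, mul_assoc]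

omit [LieGroup 𝓘(ℝ, E) ∞ G] in
lemma support_lieDeriv_subset (v : GroupLieAlgebra 𝓘(ℝ, E) G) (φ : G → F) :
    tsupport (lieDeriv v φ) ⊆ tsupport φ := by
  refine closure_minimal (fun x hx => ?_) (isClosed_tsupport φ)
  by_contra h
  apply hx
  have h0 : φ =ᶠ[𝓝 x] fun _ => 0 := notMem_tsupport_iff_eventuallyEq.mp h
  simp only [lieDeriv]
  rw [h0.mfderiv_eq, mfderiv_const]
  rfl

omit [LieGroup 𝓘(ℝ, E) ∞ G] in
lemma hasCompactSupport_lieDeriv (v : GroupLieAlgebra 𝓘(ℝ, E) G) {φ : G → F}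
    (h : HasCompactSupport φ) : HasCompactSupport (lieDeriv v φ) :=
  IsCompact.of_isClosed_subset h (isClosed_tsupport _) (support_lieDeriv_subset v φ)

lemma lieDeriv_eq_of_hasDerivAt {v : GroupLieAlgebra 𝓘(ℝ, E) G} {φ : G → F}
    (hφ : ContMDiff 𝓘(ℝ, E) 𝓘(ℝ, F) ∞ φ) {x : G} {a : F}
    (h : HasDerivAt (fun t : ℝ => φ (x * chartParam E G (t • algVec E G v))) a 0) :
    lieDeriv v φ x = a :=
  (hasDerivAt_lieDeriv v hφ x).unique h

lemma lieDeriv_add (v : GroupLieAlgebra 𝓘(ℝ, E) G) {φ ψ : G → F}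
    (hφ : ContMDiff 𝓘(ℝ, E) 𝓘(ℝ, F) ∞ φ) (hψ : ContMDiff 𝓘(ℝ, E) 𝓘(ℝ, F) ∞ ψ) :
    lieDeriv v (φ + ψ) = lieDeriv v φ + lieDeriv v ψ := by
  ext x
  exact lieDeriv_eq_of_hasDerivAt (hφ.add hψ)
    ((hasDerivAt_lieDeriv v hφ x).add (hasDerivAt_lieDeriv v hψ x))

/-- The chain rule for a left-invariant derivative. -/
lemma lieDeriv_comp {F' : Type*} [NormedAddCommGroup F'] [NormedSpace ℝ F']
    (v : GroupLieAlgebra 𝓘(ℝ, E) G) {φ : G → F} (hφ : ContMDiff 𝓘(ℝ, E) 𝓘(ℝ, F) ∞ φ)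
    {Φ : F → F'} (hΦ : ContDiff ℝ ∞ Φ) (x : G) :
    lieDeriv v (fun y => Φ (φ y)) x = fderiv ℝ Φ (φ x) (lieDeriv v φ x) := by
  refine lieDeriv_eq_of_hasDerivAt (hΦ.contMDiff.comp hφ) ?_
  have h1 : HasFDerivAt Φ (fderiv ℝ Φ (φ x))
      ((fun t : ℝ => φ (x * chartParam E G (t • algVec E G v))) 0) := by
    simpa using (hΦ.contDiffAt.differentiableAt (by simp)).hasFDerivAt
  exact h1.comp_hasDerivAt (0 : ℝ) (hasDerivAt_lieDeriv v hφ x)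

lemma lieDeriv_clm_comp {F' : Type*} [NormedAddCommGroup F'] [NormedSpace ℝ F']
    (v : GroupLieAlgebra 𝓘(ℝ, E) G) {φ : G → F} (hφ : ContMDiff 𝓘(ℝ, E) 𝓘(ℝ, F) ∞ φ)
    (L : F →L[ℝ] F') (x : G) :
    lieDeriv v (fun y => L (φ y)) x = L (lieDeriv v φ x) := by
  rw [lieDeriv_comp v hφ L.contDiff, L.fderiv]

lemma lieDeriv_const_smul (v : GroupLieAlgebra 𝓘(ℝ, E) G) {φ : G → ℂ}
    (hφ : ContMDiff 𝓘(ℝ, E) 𝓘(ℝ, ℂ) ∞ φ) (c : ℂ) :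
    lieDeriv v (c • φ) = c • lieDeriv v φ := by
  ext x
  exact lieDeriv_clm_comp v hφ ((ContinuousLinearMap.mul ℝ ℂ) c) x

/-- The product rule for the integrand `conj ψ * φ` of an inner product. -/
lemma lieDeriv_conj_mul (v : GroupLieAlgebra 𝓘(ℝ, E) G) {φ ψ : G → ℂ}
    (hφ : ContMDiff 𝓘(ℝ, E) 𝓘(ℝ, ℂ) ∞ φ) (hψ : ContMDiff 𝓘(ℝ, E) 𝓘(ℝ, ℂ) ∞ ψ) (x : G) :
    lieDeriv v (fun y => starRingEnd ℂ (ψ y) * φ y) x =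
      starRingEnd ℂ (lieDeriv v ψ x) * φ x + starRingEnd ℂ (ψ x) * lieDeriv v φ x := by
  have hc : ContMDiff 𝓘(ℝ, E) 𝓘(ℝ, ℂ) ∞ fun y => starRingEnd ℂ (ψ y) :=
    Complex.conjCLE.contDiff.contMDiff.comp hψ
  refine lieDeriv_eq_of_hasDerivAt (contDiff_mul.contMDiff.comp (hc.prodMk_space hφ)) ?_
  have h1 := (hasDerivAt_lieDeriv v hc x).fun_mul (hasDerivAt_lieDeriv v hφ x)
  have h2 : lieDeriv v (fun y => starRingEnd ℂ (ψ y)) x = starRingEnd ℂ (lieDeriv v ψ x) :=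
    lieDeriv_clm_comp v hψ (Complex.conjCLE : ℂ →L[ℝ] ℂ) x
  simp only [h2, zero_smul, chartParam_zero, mul_one] at h1
  exact h1

end Calculus

/-! ### The modular function and the measures `μ_χ` -/

section Measures

variable {G : Type*} [TopologicalSpace G] [Group G] [IsTopologicalGroup G] [LocallyCompactSpace G]

lemma modularFun_pos (y : G) : 0 < modularFun y :=
  NNReal.coe_pos.2 (Measure.modularCharacterFun_pos _)

lemma modularFun_mul (x y : G) : modularFun (x * y) = modularFun x * modularFun y := by
  simp [modularFun, mul_comm]

/-- The character `χ δ⁻¹`, the density of `μ_χ` with respect to the left Haar measure. -/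
def leftDensity (χ : G →* ℝ) : G →* ℝ where
  toFun x := χ x * (modularFun x)⁻¹
  map_one' := by simp [modularFun]
  map_mul' x y := by rw [map_mul, modularFun_mul, mul_inv]; ring

lemma leftDensity_pos {χ : G →* ℝ} (hχ : ∀ x, 0 < χ x) (x : G) : 0 < leftDensity χ x :=
  mul_pos (hχ x) (inv_pos.2 (modularFun_pos x))

variable [MeasurableSpace G] [BorelSpace G] [SecondCountableTopology G]
  (lam : Measure G) [lam.IsHaarMeasure]

/-- The relation `lam (A y) = δ(y) lam (A)` as a statement on the image of `lam`. -/
lemma map_mul_right_haar (y : G) :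
    lam.map (· * y) = ENNReal.ofReal (modularFun y)⁻¹ • lam := by
  have h1 : lam.map (· * y) = Measure.modularCharacterFun y • lam := by
    rw [Measure.modularCharacterFun_eq_haarScalarFactor lam]
    exact Measure.isMulLeftInvariant_eq_smul _ _
  have h2 : ENNReal.ofReal (modularFun y)⁻¹ = (Measure.modularCharacterFun y : ℝ≥0∞) := by
    have : (modularFun y)⁻¹ = (Measure.modularCharacterFun y : ℝ) := by
      simp only [modularFun, map_inv, NNReal.coe_inv, inv_inv]; rfl
    rw [this, ENNReal.ofReal_coe_nnreal]
  rw [h1, h2]; rfl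

variable (G) in
/-- The modular function is a quotient of integrals of a compactly supported function, one of which
depends continuously on a right translation. -/
lemma continuous_modularFun : Continuous (modularFun : G → ℝ) := by
  let ν : Measure G := Measure.haar
  obtain ⟨f, f_comp, f_nonneg, f_one⟩ :
    ∃ f : C(G, ℝ), HasCompactSupport f ∧ 0 ≤ f ∧ f 1 ≠ 0 := exists_continuous_nonneg_pos 1
  have hpos : 0 < ∫ x, f x ∂ν :=
    f.continuous.integral_pos_of_hasCompactSupport_nonneg_nonzero f_comp f_nonneg f_one
  have h1 : ∀ y, (modularFun y)⁻¹ = (∫ x, f (x * y) ∂ν) / ∫ x, f x ∂ν := by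
    intro y
    have h2 : ∫ x, f (x * y) ∂ν = ∫ x, f x ∂(ν.map (· * y)) :=
      (integral_map (by fun_prop) f.continuous.aestronglyMeasurable).symm
    rw [h2, map_mul_right_haar, integral_smul_measure,
      ENNReal.toReal_ofReal (inv_nonneg.2 (modularFun_pos y).le), smul_eq_mul,
      mul_div_cancel_right₀ _ hpos.ne']
  have h3 : Continuous fun y => ∫ x, f (x * y) ∂ν := by
    have := continuous_integral_apply_inv_mul (μ := ν.inv) f.continuous f_comp
    refine this.congr fun y => ?_
    rw [Measure.inv, integral_map (by fun_prop)]
    · simp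
    · exact (f.continuous.comp (by fun_prop)).aestronglyMeasurable
  have h4 : Continuous fun y : G => (modularFun y)⁻¹ := by
    simp_rw [h1]; exact h3.div_const _
  exact (h4.inv₀ fun y => inv_ne_zero (modularFun_pos y).ne').congr fun y => inv_inv _

lemma continuous_leftDensity {χ : G →* ℝ} (hχ : Continuous χ) : Continuous (leftDensity χ) :=
  hχ.mul ((continuous_modularFun G).inv₀ fun y => (modularFun_pos y).ne')

omit [lam.IsHaarMeasure] in
lemma muChi_eq_withDensity {χ : G →* ℝ} (hχ : Continuous χ) :
    muChi lam χ = lam.withDensity fun x => ENNReal.ofReal (leftDensity χ x) := by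
  have hm := (continuous_modularFun G).measurable
  rw [muChi, rightHaar, ← withDensity_mul]
  · congr 1
    ext x
    simp only [Pi.mul_apply, leftDensity, MonoidHom.coe_mk, OneHom.coe_mk]
    rw [← ENNReal.ofReal_mul (inv_nonneg.2 (modularFun_pos x).le), mul_comm]
  · exact hm.inv.ennreal_ofReal
  · exact hχ.measurable.ennreal_ofReal

/-- Left translation by `y` multiplies `μ_χ` by a constant, which is `1` for all `y` only if
`μ_χ` is the left Haar measure. -/
lemma map_mul_left_muChi {χ : G →* ℝ} (hχ : Continuous χ) (hpos : ∀ x, 0 < χ x) (y : G) :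
    (muChi lam χ).map (y * ·) = ENNReal.ofReal (leftDensity χ y)⁻¹ • muChi lam χ := by
  have hm : Measurable fun x => ENNReal.ofReal (leftDensity χ x) :=
    (continuous_leftDensity hχ).measurable.ennreal_ofReal
  rw [muChi_eq_withDensity lam hχ]
  ext s hs
  rw [Measure.map_apply (by fun_prop) hs, withDensity_apply _ ((measurable_const_mul y) hs),
    Measure.smul_apply, withDensity_apply _ hs, ← lintegral_indicator hs,
    ← lintegral_indicator ((measurable_const_mul y) hs), smul_eq_mul]
  conv_rhs => rw [← lintegral_mul_left_eq_self _ y]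
  rw [← lintegral_const_mul _ ?_]
  · refine lintegral_congr fun x => ?_
    by_cases h : y * x ∈ s
    · rw [Set.indicator_of_mem h, Set.indicator_of_mem (by exact h),
        ← ENNReal.ofReal_mul (inv_nonneg.2 (leftDensity_pos hpos y).le), map_mul,
        inv_mul_cancel_left₀ (leftDensity_pos hpos y).ne']
    · rw [Set.indicator_of_notMem h, Set.indicator_of_notMem (by exact h), mul_zero]
  · exact (hm.indicator hs).comp (by fun_prop)

lemma map_mul_right_muChi {χ : G →* ℝ} (hχ : Continuous χ) (hpos : ∀ x, 0 < χ x) (y : G) :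
    (muChi lam χ).map (· * y) = ENNReal.ofReal (χ y)⁻¹ • muChi lam χ := by
  have hm : Measurable fun x => ENNReal.ofReal (leftDensity χ x) :=
    (continuous_leftDensity hχ).measurable.ennreal_ofReal
  have hy : lam = ENNReal.ofReal (modularFun y) • lam.map (· * y) := by
    rw [map_mul_right_haar, smul_smul, ← ENNReal.ofReal_mul (modularFun_pos y).le,
      mul_inv_cancel₀ (modularFun_pos y).ne', ENNReal.ofReal_one, one_smul]
  rw [muChi_eq_withDensity lam hχ]
  ext s hs
  rw [Measure.map_apply (by fun_prop) hs, withDensity_apply _ ((measurable_mul_const y) hs),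
    Measure.smul_apply, withDensity_apply _ hs, ← lintegral_indicator hs,
    ← lintegral_indicator ((measurable_mul_const y) hs), smul_eq_mul]
  conv_rhs => rw [hy]
  rw [lintegral_smul_measure, smul_eq_mul, lintegral_map (hm.indicator hs) (by fun_prop),
    ← mul_assoc, ← ENNReal.ofReal_mul (inv_nonneg.2 (hpos y).le), ← lintegral_const_mul _ ?_]
  · refine lintegral_congr fun x => ?_
    by_cases h : x * y ∈ s
    · rw [Set.indicator_of_mem h, Set.indicator_of_mem (by exact h),
        ← ENNReal.ofReal_mul (mul_nonneg (inv_nonneg.2 (hpos y).le) (modularFun_pos y).le), map_mul]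
      congr 1
      have h1 := (hpos y).ne'
      have h2 := (modularFun_pos y).ne'
      simp only [leftDensity, MonoidHom.coe_mk, OneHom.coe_mk]
      field_simp
    · rw [Set.indicator_of_notMem h, Set.indicator_of_notMem (by exact h), mul_zero]
  · exact (hm.indicator hs).comp (by fun_prop)

lemma isLocallyFiniteMeasure_muChi {χ : G →* ℝ} (hχ : Continuous χ) :
    IsLocallyFiniteMeasure (muChi lam χ) := by
  rw [muChi_eq_withDensity lam hχ]
  exact IsLocallyFiniteMeasure.withDensity_ofReal (continuous_leftDensity hχ)

lemma isOpenPosMeasure_muChi {χ : G →* ℝ} (hχ : Continuous χ) (hpos : ∀ x, 0 < χ x) :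
    (muChi lam χ).IsOpenPosMeasure := by
  rw [muChi_eq_withDensity lam hχ]
  refine (withDensity_absolutelyContinuous' (continuous_leftDensity
    hχ).measurable.ennreal_ofReal.aemeasurable (Eventually.of_forall fun x => ?_)).isOpenPosMeasure
  simpa using leftDensity_pos hpos x

end Measures

/-! ### Integration by parts for left-invariant vector fields -/

section Parts

variable {E : Type*} [NormedAddCommGroup E] [NormedSpace ℝ E] [FiniteDimensional ℝ E]
  {G : Type*} [TopologicalSpace G] [ChartedSpace E G] [Group G] [LieGroup 𝓘(ℝ, E) ∞ G]
  [IsTopologicalGroup G] [T2Space G] [SecondCountableTopology G] [MeasurableSpace G] [BorelSpace G]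
  {F : Type*} [NormedAddCommGroup F] [NormedSpace ℝ F]

/-- Differentiation under the integral sign of the right translates of a test function. -/
lemma hasFDerivAt_integral_mul_chartParam (μ : Measure G) [IsFiniteMeasureOnCompacts μ]
    {φ : G → F} (hφ : ContMDiff 𝓘(ℝ, E) 𝓘(ℝ, F) ∞ φ) (hc : HasCompactSupport φ) :
    Integrable (fun x => fderiv ℝ (fun w : E => φ (x * chartParam E G w)) 0) μ ∧
    HasFDerivAt (fun w : E => ∫ x, φ (x * chartParam E G w) ∂μ)
      (∫ x, fderiv ℝ (fun w : E => φ (x * chartParam E G w)) 0 ∂μ) 0 := by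
  have : ProperSpace E := FiniteDimensional.proper ℝ E
  obtain ⟨r, hr, hsub⟩ := (Metric.nhds_basis_closedBall (x := (0 : E))).mem_iff.1
    (eventually_contMDiffAt_chartParam E G)
  have hcont : ContinuousOn (chartParam E G) (Metric.closedBall 0 r) := fun w hw =>
    (hsub hw : ContMDiffAt _ _ _ _ _).continuousAt.continuousWithinAt
  have hK1 : IsCompact (chartParam E G '' Metric.closedBall 0 r) :=
    (isCompact_closedBall (0 : E) r).image_of_continuousOn hcont
  have hK : IsCompact ((fun q : G × G => q.1 * q.2⁻¹) ''
      (tsupport φ ×ˢ (chartParam E G '' Metric.closedBall 0 r))) :=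
    (hc.isCompact.prod hK1).image (by fun_prop)
  -- a compact set containing the supports of all the translates for `‖w‖ ≤ r`
  set K := (fun q : G × G => q.1 * q.2⁻¹) ''
      (tsupport φ ×ˢ (chartParam E G '' Metric.closedBall 0 r)) with hKdef
  have hout : ∀ x ∉ K, ∀ w ∈ Metric.closedBall (0 : E) r, φ (x * chartParam E G w) = 0 := by
    intro x hx w hw
    by_contra h
    exact hx ⟨(x * chartParam E G w, chartParam E G w),
      ⟨subset_tsupport _ h, ⟨w, hw, rfl⟩⟩, by simp⟩
  have hΨ : ContinuousOn (fun q : G × E => fderiv ℝ (fun w => φ (q.1 * chartParam E G w)) q.2)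
      (K ×ˢ Metric.closedBall 0 r) := fun q hq =>
    (contMDiffAt_fderiv_chartParam hφ (hsub hq.2) q.1).continuousAt.continuousWithinAt
  obtain ⟨B, hB⟩ := (hK.prod (isCompact_closedBall (0 : E) r)).exists_bound_of_continuousOn hΨ
  have hbound : ∀ x, ∀ w ∈ Metric.ball (0 : E) r,
      ‖fderiv ℝ (fun w => φ (x * chartParam E G w)) w‖ ≤ K.indicator (fun _ => B) x := by
    intro x w hw
    by_cases hx : x ∈ K
    · rw [Set.indicator_of_mem hx]
      exact hB (x, w) ⟨hx, Metric.ball_subset_closedBall hw⟩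
    · rw [Set.indicator_of_notMem hx]
      have h0 : (fun w => φ (x * chartParam E G w)) =ᶠ[𝓝 w] fun _ => 0 := by
        filter_upwards [Metric.isOpen_ball.mem_nhds hw] with w' hw'
        exact hout x hx w' (Metric.ball_subset_closedBall hw')
      rw [h0.fderiv_eq]; simp
  have hBint : Integrable (K.indicator fun _ => B) μ :=
    (integrable_indicator_iff hK.measurableSet).2 (integrableOn_const hK.measure_lt_top.ne)
  have hmeas : AEStronglyMeasurable
      (fun x => fderiv ℝ (fun w : E => φ (x * chartParam E G w)) 0) μ := by
    refine Continuous.aestronglyMeasurable (continuous_iff_continuousAt.2 fun x => ?_)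
    exact ContinuousAt.comp (g := fun q : G × E =>
      fderiv ℝ (fun w => φ (q.1 * chartParam E G w)) q.2) (f := fun x => (x, (0 : E)))
      (contMDiffAt_fderiv_chartParam hφ contMDiffAt_chartParam_zero x).continuousAt (by fun_prop)
  refine ⟨hBint.mono' hmeas
    (Eventually.of_forall fun x => hbound x 0 (Metric.mem_ball_self hr)), ?_⟩
  refine hasFDerivAt_integral_of_dominated_of_fderiv_le (Metric.ball_mem_nhds 0 hr)
    (Eventually.of_forall fun w => ?_) ?_ hmeas (Eventually.of_forall hbound) hBint
    (Eventually.of_forall fun x w hw => ?_)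
  · exact (hφ.continuous.comp (by fun_prop)).aestronglyMeasurable
  · simpa using hφ.continuous.integrable_of_hasCompactSupport hc
  · exact (differentiableAt_mul_chartParam hφ
      (hsub (Metric.ball_subset_closedBall hw)) x).hasFDerivAt

lemma integral_fderiv_chartParam (μ : Measure G) [IsFiniteMeasureOnCompacts μ] [CompleteSpace F]
    {φ : G → F} (hφ : ContMDiff 𝓘(ℝ, E) 𝓘(ℝ, F) ∞ φ) (hc : HasCompactSupport φ)
    (v : GroupLieAlgebra 𝓘(ℝ, E) G) :
    (∫ x, fderiv ℝ (fun w : E => φ (x * chartParam E G w)) 0 ∂μ) (algVec E G v) =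
      ∫ x, lieDeriv v φ x ∂μ := by
  rw [ContinuousLinearMap.integral_apply (hasFDerivAt_integral_mul_chartParam μ hφ hc).1]
  simp_rw [lieDeriv_eq_fderiv v hφ]

variable [LocallyCompactSpace G] (lam : Measure G) [lam.IsHaarMeasure]

omit [FiniteDimensional ℝ E] [LieGroup 𝓘(ℝ, E) ∞ G] [T2Space G] in
lemma integral_mul_chartParam_muChi {χ : G →* ℝ} (hχ : Continuous χ) (hpos : ∀ x, 0 < χ x)
    {φ : G → F} (hφ : Continuous φ) (w : E) :
    ∫ x, φ (x * chartParam E G w) ∂(muChi lam χ) =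
      (χ (chartParam E G w))⁻¹ • ∫ x, φ x ∂(muChi lam χ) := by
  have h2 : ∫ x, φ (x * chartParam E G w) ∂(muChi lam χ) =
      ∫ x, φ x ∂((muChi lam χ).map (· * chartParam E G w)) :=
    (integral_map (by fun_prop) hφ.aestronglyMeasurable).symm
  rw [h2, map_mul_right_muChi lam hχ hpos, integral_smul_measure,
    ENNReal.toReal_ofReal (inv_nonneg.2 (hpos _).le)]

variable (E G) in
omit [IsTopologicalGroup G] [SecondCountableTopology G] [MeasurableSpace G] [BorelSpace G]
  [LocallyCompactSpace G] in
lemma exists_bump : ∃ φ : G → ℝ, ContMDiff 𝓘(ℝ, E) 𝓘(ℝ, ℝ) ∞ φ ∧ HasCompactSupport φ ∧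
    (∀ x, 0 ≤ φ x) ∧ φ 1 = 1 := by
  obtain ⟨f⟩ : Nonempty (SmoothBumpFunction 𝓘(ℝ, E) (1 : G)) := inferInstance
  exact ⟨f, f.contMDiff, f.hasCompactSupport, fun x => f.nonneg, f.eq_one⟩

/-- A continuous character is differentiable: `χ(w)⁻¹ ∫ φ dμ_χ` is the integral of a right translate
of `φ`, and it is differentiable in `w` when `φ` is a test function. -/
lemma differentiableAt_character_comp_chartParam {χ : G →* ℝ} (hχ : Continuous χ)
    (hpos : ∀ x, 0 < χ x) :
    DifferentiableAt ℝ (fun w : E => χ (chartParam E G w)) 0 := by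
  let lam : Measure G := Measure.haar
  have := isLocallyFiniteMeasure_muChi lam hχ
  have := isOpenPosMeasure_muChi lam hχ hpos
  obtain ⟨φ, hφ, hc, h0, h1⟩ := exists_bump E G
  have hI : 0 < ∫ x, φ x ∂(muChi lam χ) :=
    hφ.continuous.integral_pos_of_hasCompactSupport_nonneg_nonzero hc h0 (x := 1) (by simp [h1])
  have hd := (hasFDerivAt_integral_mul_chartParam (muChi lam χ) hφ hc).2.differentiableAt
  simp_rw [integral_mul_chartParam_muChi lam hχ hpos hφ.continuous, smul_eq_mul] at hd
  have h2 := (hd.mul_const (∫ x, φ x ∂(muChi lam χ))⁻¹).inv (by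
    simpa using hI.ne')
  refine h2.congr_of_eventuallyEq (Eventually.of_forall fun w => ?_)
  simp [mul_assoc, mul_inv_cancel₀ hI.ne']

lemma mdifferentiableAt_character {χ : G →* ℝ} (hχ : Continuous χ) (hpos : ∀ x, 0 < χ x) :
    MDifferentiableAt 𝓘(ℝ, E) 𝓘(ℝ, ℝ) χ 1 := by
  refine mdifferentiableAt_iff _ _ |>.2 ⟨hχ.continuousAt, ?_⟩
  have h1 := differentiableAt_character_comp_chartParam (E := E) hχ hpos
  have h2 : DifferentiableAt ℝ (fun w : E => w - extChartAt 𝓘(ℝ, E) (1 : G) 1)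
    (extChartAt 𝓘(ℝ, E) (1 : G) 1) := by fun_prop
  have h3 : DifferentiableAt ℝ ((fun w : E => χ (chartParam E G w)) ∘
      fun w : E => w - extChartAt 𝓘(ℝ, E) (1 : G) 1) (extChartAt 𝓘(ℝ, E) (1 : G) 1) :=
    DifferentiableAt.comp _ (by simpa using h1) h2
  refine DifferentiableAt.differentiableWithinAt
    (h3.congr_of_eventuallyEq (Eventually.of_forall fun w => ?_))
  simp only [writtenInExtChartAt, chartParam, Function.comp_apply, add_sub_cancel,
    extChartAt_model_space_eq_id, PartialEquiv.refl_coe, id]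

/-- Differentiating `∫ φ (x c) dμ_χ (x) = χ(c)⁻¹ ∫ φ dμ_χ` in `c` at the identity. -/
lemma integral_lieDeriv {χ : G →* ℝ} (hχ : Continuous χ) (hpos : ∀ x, 0 < χ x) [CompleteSpace F]
    {φ : G → F} (hφ : ContMDiff 𝓘(ℝ, E) 𝓘(ℝ, F) ∞ φ) (hc : HasCompactSupport φ)
    (v : GroupLieAlgebra 𝓘(ℝ, E) G) :
    ∫ x, lieDeriv v φ x ∂(muChi lam χ) = -(lieDeriv v χ 1 • ∫ x, φ x ∂(muChi lam χ)) := by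
  have := isLocallyFiniteMeasure_muChi lam hχ
  have h1 := (hasFDerivAt_integral_mul_chartParam (muChi lam χ) hφ hc).2
  simp_rw [integral_mul_chartParam_muChi lam hχ hpos hφ.continuous] at h1
  have h2 := (differentiableAt_character_comp_chartParam (E := E) hχ hpos).hasFDerivAt
  have h3 := ((hasDerivAt_inv (by simp : χ (chartParam E G 0) ≠ 0)).comp_hasFDerivAt (0 : E)
    h2).smul_const (∫ x, φ x ∂(muChi lam χ))
  have h4 := congrArg (fun L : E →L[ℝ] F => L (algVec E G v)) (h1.unique h3)
  have h5 := lieDeriv_eq_fderiv_of_mdifferentiableAt v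
    (mdifferentiableAt_character (E := E) hχ hpos)
  simp only [one_mul] at h5
  rw [← integral_fderiv_chartParam _ hφ hc, h5]
  refine h4.trans ?_
  simp

end Parts

/-! ### The resolvent of a form -/

section Form

open scoped InnerProductSpace
variable {T H K : Type*} [AddCommGroup T] [Module ℂ T]
  [NormedAddCommGroup H] [InnerProductSpace ℂ H] [CompleteSpace H]
  [NormedAddCommGroup K] [InnerProductSpace ℂ K] [CompleteSpace K]

/-- Let `A` be an operator with form `τ ⟪ι ψ, ι φ⟫ + ⟪δ ψ, δ φ⟫` on a space `T` of test functions.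
Then there is a bounded positive operator `R` inverting `A` on `T`; moreover `R y` is a weak
solution of `A z = y` in the closure of the form domain.

On the closure `W` of the graph of `φ ↦ (√τ ι φ, δ φ)` let `J : W → H` be `1/√τ` times the first
projection; then `R = J J*`. The form need not be closable, as `J` need not be injective. -/
theorem exists_form_resolvent (ι : T →ₗ[ℂ] H) (δ : T →ₗ[ℂ] K) (A : T → H) {τ : ℝ} (hτ : 0 < τ)
    (hA : ∀ φ ψ, ⟪ι ψ, A φ⟫_ℂ = τ * ⟪ι ψ, ι φ⟫_ℂ + ⟪δ ψ, δ φ⟫_ℂ) :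
    ∃ R : H →L[ℂ] H, 0 ≤ R ∧ (∀ φ, R (A φ) = ι φ) ∧
      ∀ y, ∃ (k : K) (φ : ℕ → T), Tendsto (fun n => ι (φ n)) atTop (𝓝 (R y)) ∧
        Tendsto (fun n => δ (φ n)) atTop (𝓝 k) ∧
        ∀ ψ, τ * ⟪ι ψ, R y⟫_ℂ + ⟪δ ψ, k⟫_ℂ = ⟪ι ψ, y⟫_ℂ := by
  have hs : (0 : ℝ) < √τ := Real.sqrt_pos.2 hτ
  have hsC : ((√τ : ℝ) : ℂ) ≠ 0 := by exact_mod_cast hs.ne'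
  have hsq : ((√τ : ℝ) : ℂ) * ((√τ : ℝ) : ℂ) = τ := by
    exact_mod_cast Real.mul_self_sqrt hτ.le
  let L := WithLp.prodContinuousLinearEquiv 2 ℂ H K
  -- the scaled graph of `δ` over `ι`: its `L²` inner product is the form of `A`
  let j : T →ₗ[ℂ] WithLp 2 (H × K) :=
    L.symm.toLinearMap ∘ₗ ((((√τ : ℝ) : ℂ) • ι).prod δ)
  let W : Submodule ℂ (WithLp 2 (H × K)) := (LinearMap.range j).topologicalClosure
  have : CompleteSpace W := (Submodule.isClosed_topologicalClosure _).completeSpace_coe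
  let J : W →L[ℂ] H := (((√τ : ℝ) : ℂ)⁻¹) •
    ((ContinuousLinearMap.fst ℂ H K).comp (L : WithLp 2 (H × K) →L[ℂ] H × K)).comp W.subtypeL
  have hjW : ∀ φ, j φ ∈ W := fun φ => Submodule.le_topologicalClosure _ ⟨φ, rfl⟩
  have hJ : ∀ φ, J ⟨j φ, hjW φ⟩ = ι φ := by
    intro φ
    change (((√τ : ℝ) : ℂ)⁻¹) • (((√τ : ℝ) : ℂ) • ι φ) = ι φ
    exact inv_smul_smul₀ hsC _
  have hadj : ∀ φ y, ⟪(⟨j φ, hjW φ⟩ : W), J.adjoint y⟫_ℂ = ⟪ι φ, y⟫_ℂ := by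
    intro φ y
    rw [ContinuousLinearMap.adjoint_inner_right, hJ]
  have hinner : ∀ (φ : T) (Z : W), ⟪(⟨j φ, hjW φ⟩ : W), Z⟫_ℂ =
      τ * ⟪ι φ, J Z⟫_ℂ + ⟪δ φ, (L (Z : WithLp 2 (H × K))).2⟫_ℂ := by
    intro φ Z
    rw [Submodule.coe_inner, WithLp.prod_inner_apply]
    have : J Z = (((√τ : ℝ) : ℂ)⁻¹) • (L (Z : WithLp 2 (H × K))).1 := rfl
    rw [this, inner_smul_right, ← hsq]
    have h2 : (j φ).fst = ((√τ : ℝ) : ℂ) • ι φ := rfl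
    have h3 : (j φ).snd = δ φ := rfl
    change ⟪(j φ).fst, _⟫_ℂ + ⟪(j φ).snd, _⟫_ℂ = _
    rw [h2, h3, inner_smul_left, Complex.conj_ofReal]
    congr 1
    rw [mul_assoc, mul_inv_cancel_left₀ hsC]
    rfl
  refine ⟨J.comp J.adjoint, ?_, ?_, ?_⟩
  · rw [ContinuousLinearMap.nonneg_iff_isPositive]
    exact ContinuousLinearMap.isPositive_self_comp_adjoint J
  · intro φ
    have : J.adjoint (A φ) = ⟨j φ, hjW φ⟩ := by
      have hz : ∀ w ∈ W, ⟪w, ((J.adjoint (A φ) : W) : WithLp 2 (H × K)) - j φ⟫_ℂ = 0 := by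
        intro w hw
        refine closure_minimal (t := {w | ⟪w, _⟫_ℂ = 0}) ?_ (isClosed_eq (by fun_prop)
          continuous_const) hw
        rintro _ ⟨ψ, rfl⟩
        have h1 := hadj ψ (A φ)
        have h2 := hinner ψ ⟨j φ, hjW φ⟩
        rw [hA, ← hJ φ] at h1
        rw [Submodule.coe_inner] at h1 h2
        rw [Set.mem_ofPred_eq, inner_sub_right, h1, h2, sub_eq_zero]
        rfl
      refine Subtype.ext (sub_eq_zero.1 (inner_self_eq_zero.1 (hz _ ?_)))
      exact W.sub_mem (J.adjoint (A φ)).2 (hjW φ)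
    rw [ContinuousLinearMap.comp_apply, this, hJ]
  · intro y
    obtain ⟨u, hu, hlim⟩ := mem_closure_iff_seq_limit.1 (J.adjoint y).2
    choose φ hφ using hu
    refine ⟨(L ((J.adjoint y : W) : WithLp 2 (H × K))).2, φ, ?_, ?_, fun ψ => ?_⟩
    · have h1 : Tendsto (fun n => (⟨j (φ n), hjW _⟩ : W)) atTop (𝓝 (J.adjoint y)) := by
        rw [tendsto_subtype_rng]; simpa [hφ] using hlim
      have := (J.continuous.tendsto _).comp h1
      simpa [Function.comp_def, hJ] using this
    · have := ((L.continuous.tendsto _).comp hlim).snd_nhds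
      simpa [Function.comp_def, ← hφ, j] using this
    · rw [ContinuousLinearMap.comp_apply, ← hinner, hadj]

end Form

/-! ### Fractional powers of positive operators -/

section Powers

open scoped InnerProductSpace
variable {H : Type*} [NormedAddCommGroup H] [InnerProductSpace ℂ H] [CompleteSpace H]
  {R : H →L[ℂ] H}

omit [CompleteSpace H] in
lemma continuousOn_rpow_spectrum (R : H →L[ℂ] H) {s : ℝ} (hs : 0 < s) :
    ContinuousOn (fun r : ℝ => r ^ s) (spectrum ℝ R) :=
  (Real.continuous_rpow_const hs.le).continuousOn

lemma opPow_one (hR : 0 ≤ R) : opPow R 1 = R := by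
  simp only [opPow, Real.rpow_one]
  exact cfc_id' ℝ R hR.isSelfAdjoint

lemma opPow_add (hR : 0 ≤ R) {s t : ℝ} (hs : 0 < s) (ht : 0 < t) :
    opPow R (s + t) = opPow R s * opPow R t := by
  rw [opPow, opPow, opPow, ← cfc_mul _ _ R (continuousOn_rpow_spectrum R hs)
    (continuousOn_rpow_spectrum R ht)]
  refine cfc_congr fun r hr => ?_
  exact Real.rpow_add_of_nonneg (spectrum_nonneg_of_nonneg hR hr) hs.le ht.le

lemma opPow_natCast_succ (hR : 0 ≤ R) (n : ℕ) : opPow R ((n + 1 : ℕ) : ℝ) = R ^ (n + 1) := by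
  induction n with
  | zero => simp [opPow_one hR]
  | succ n ih =>
    rw [Nat.cast_succ, opPow_add hR (by positivity) one_pos, ih, opPow_one hR, ← pow_succ]

/-- `R ^ s`, `0 < s < 1`, is a positive average of the operators `R (t + R)⁻¹`, so bounds on matrix
coefficients pass from these to `R ^ s`. The constant is right because the same integral formula
for the number `R = 1` has value `1`. -/
lemma norm_inner_opPow_le (hR : 0 ≤ R) {s : ℝ} (hs : s ∈ Set.Ioo 0 1) {w u : H} {B : ℝ}
    (h : ∀ t : ℝ, 0 < t → ∀ y, (t : ℂ) • y + R y = u → ‖⟪w, R y⟫_ℂ‖ ≤ B / (1 + t)) :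
    ‖⟪w, opPow R s u⟫_ℂ‖ ≤ B := by
  obtain ⟨μ, hμ⟩ := Real.exists_measure_rpow_eq_integral_rpowIntegrand₀₁ hs
  have hsp : spectrum ℝ R ⊆ Set.Ici 0 := fun r hr => spectrum_nonneg_of_nonneg hR hr
  have hcont : ContinuousOn (Function.uncurry (Real.rpowIntegrand₀₁ s))
      (Set.Ioi 0 ×ˢ spectrum ℝ R) := Real.continuousOn_rpowIntegrand₀₁_uncurry hs _ hsp
  have hbound : ∀ᵐ t ∂μ.restrict (Set.Ioi 0), ∀ z ∈ spectrum ℝ R,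
      ‖Real.rpowIntegrand₀₁ s t z‖ ≤ Real.rpowIntegrand₀₁ s t (‖R‖ * ‖(1 : H →L[ℂ] H)‖) := by
    filter_upwards [ae_restrict_mem measurableSet_Ioi] with t ht z hz
    rw [Real.norm_of_nonneg (Real.rpowIntegrand₀₁_nonneg hs.1 (le_of_lt ht) (hsp hz))]
    refine Real.rpowIntegrand₀₁_monotoneOn hs (le_of_lt ht) (hsp hz)
      (Set.mem_Ici.2 (by positivity)) ?_
    exact (le_abs_self z).trans (spectrum.norm_le_norm_mul_of_mem hz)
  have hfin : HasFiniteIntegral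
      (fun t => Real.rpowIntegrand₀₁ s t (‖R‖ * ‖(1 : H →L[ℂ] H)‖)) (μ.restrict (Set.Ioi 0)) :=
    (hμ _ (Set.mem_Ici.2 (by positivity))).1.2
  have hint : IntegrableOn (fun t => cfc (Real.rpowIntegrand₀₁ s t) R) (Set.Ioi 0) μ :=
    integrableOn_cfc measurableSet_Ioi _ _ R hcont hbound hfin hR.isSelfAdjoint
  have hpow : opPow R s = ∫ t in Set.Ioi 0, cfc (Real.rpowIntegrand₀₁ s t) R ∂μ := by
    rw [← cfc_setIntegral measurableSet_Ioi _ _ R hcont hbound hfin hR.isSelfAdjoint]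
    exact cfc_congr fun r hr => (hμ r (hsp hr)).2
  have happ : ⟪w, opPow R s u⟫_ℂ =
      ∫ t in Set.Ioi 0, ⟪w, cfc (Real.rpowIntegrand₀₁ s t) R u⟫_ℂ ∂μ := by
    rw [hpow, ContinuousLinearMap.integral_apply hint]
    exact (integral_inner (hint.apply_continuousLinearMap u) w).symm
  have hone := hμ 1 (by simp)
  rw [Real.one_rpow] at hone
  rw [happ]
  have hle : ∀ᵐ t ∂μ.restrict (Set.Ioi 0), ‖⟪w, cfc (Real.rpowIntegrand₀₁ s t) R u⟫_ℂ‖ ≤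
      Real.rpowIntegrand₀₁ s t 1 * B := by
    filter_upwards [ae_restrict_mem measurableSet_Ioi] with t ht
    have ht : 0 < t := ht
    have hne : ∀ x ∈ spectrum ℝ R, t + x ≠ 0 := fun x hx =>
      (add_pos_of_pos_of_nonneg ht (hsp hx)).ne'
    have hci : ContinuousOn (fun x : ℝ => (t + x)⁻¹) (spectrum ℝ R) :=
      (continuousOn_const.add continuousOn_id).inv₀ hne
    set Q : H →L[ℂ] H := cfc (fun x : ℝ => (t + x)⁻¹) R with hQ
    have hRQ : R * Q = cfc (fun x : ℝ => x * (t + x)⁻¹) R := by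
      rw [cfc_mul (fun x : ℝ => x) (fun x : ℝ => (t + x)⁻¹) R continuousOn_id hci,
        cfc_id' ℝ R hR.isSelfAdjoint]
    have h1 : (t : ℂ) • Q u + R (Q u) = u := by
      have h2 : t • Q + R * Q = 1 := by
        rw [hRQ, hQ, ← cfc_smul t (fun x : ℝ => (t + x)⁻¹) R hci,
          ← cfc_add R (fun x : ℝ => t • (t + x)⁻¹) (fun x : ℝ => x * (t + x)⁻¹)
          (continuousOn_const.mul hci) (continuousOn_id.mul hci), ← cfc_one ℝ R hR.isSelfAdjoint]
        refine cfc_congr fun x hx => ?_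
        simp only [smul_eq_mul, ← add_mul, Pi.one_apply]
        exact mul_inv_cancel₀ (hne x hx)
      have h3 := congrArg (fun L : H →L[ℂ] H => L u) h2
      simpa using h3
    have h4 : cfc (Real.rpowIntegrand₀₁ s t) R = (t ^ (s - 1)) • (R * Q) := by
      rw [hRQ, ← cfc_smul _ (fun x : ℝ => x * (t + x)⁻¹) R (continuousOn_id.mul hci)]
      refine cfc_congr fun x hx => ?_
      rw [Real.rpowIntegrand₀₁_eq_pow_div hs ht.le (hsp hx)]
      simp only [smul_eq_mul]; ring
    have h5 := h t ht (Q u) h1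
    rw [h4, Real.rpowIntegrand₀₁_eq_pow_div hs ht.le zero_le_one]
    have h6 : (t ^ (s - 1) • (R * Q)) u = ((t ^ (s - 1) : ℝ) : ℂ) • R (Q u) := by simp
    rw [h6, inner_smul_right, norm_mul, Complex.norm_real,
      Real.norm_of_nonneg (Real.rpow_nonneg ht.le _)]
    calc t ^ (s - 1) * ‖⟪w, R (Q u)⟫_ℂ‖ ≤ t ^ (s - 1) * (B / (1 + t)) :=
          mul_le_mul_of_nonneg_left h5 (Real.rpow_nonneg ht.le _)
      _ = t ^ (s - 1) * 1 / (t + 1) * B := by rw [add_comm]; ring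
  calc _ ≤ ∫ t in Set.Ioi 0, Real.rpowIntegrand₀₁ s t 1 * B ∂μ :=
        norm_integral_le_of_norm_le (hone.1.mul_const B) hle
    _ = B := by rw [integral_mul_const, ← hone.2, one_mul]

end Powers

/-! ### A smooth truncation of complex numbers -/

section Truncation

/-- The radial profile `z ↦ θ(|z|²)` of the soft truncation at level `M`. -/
def truncWeight (M : ℝ) (z : ℂ) : ℝ := Real.smoothTransition (‖z‖ ^ 2 - M ^ 2)

/-- A smooth substitute for `z ↦ (|z| - M)₊ z / |z|`. -/
def softTrunc (M : ℝ) (z : ℂ) : ℂ := truncWeight M z • z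

lemma truncWeight_nonneg (M : ℝ) (z : ℂ) : 0 ≤ truncWeight M z := Real.smoothTransition.nonneg _

lemma truncWeight_pos {M : ℝ} (hM : 0 ≤ M) {z : ℂ} (hz : M < ‖z‖) : 0 < truncWeight M z :=
  Real.smoothTransition.pos_of_pos (sub_pos.2 (pow_lt_pow_left₀ hz hM two_ne_zero))

lemma truncWeight_eq_zero {M : ℝ} {z : ℂ} (hz : ‖z‖ ≤ M) : truncWeight M z = 0 :=
  Real.smoothTransition.zero_of_nonpos (sub_nonpos.2 (pow_le_pow_left₀ (norm_nonneg z) hz 2))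

@[simp] lemma softTrunc_zero (M : ℝ) : softTrunc M 0 = 0 := by simp [softTrunc]

lemma contDiff_truncWeight (M : ℝ) : ContDiff ℝ ∞ (truncWeight M) :=
  Real.smoothTransition.contDiff.comp ((contDiff_norm_sq ℝ).sub contDiff_const)

lemma contDiff_softTrunc (M : ℝ) : ContDiff ℝ ∞ (softTrunc M) :=
  (contDiff_truncWeight M).smul contDiff_id

lemma fderiv_softTrunc (M : ℝ) (z a : ℂ) :
    fderiv ℝ (softTrunc M) z a = truncWeight M z • a +
      (deriv Real.smoothTransition (‖z‖ ^ 2 - M ^ 2) * (2 * inner ℝ z a)) • z := by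
  have h0 : HasFDerivAt (fun z : ℂ => ‖z‖ ^ 2 - M ^ 2) (2 • (innerSL ℝ z)) z :=
    (hasStrictFDerivAt_norm_sq z).hasFDerivAt.sub_const _
  have h1 : HasFDerivAt (truncWeight M) _ z :=
    HasDerivAt.comp_hasFDerivAt z ((Real.smoothTransition.contDiff (n := (⊤ : ℕ∞))).differentiable
      (by simp) (‖z‖ ^ 2 - M ^ 2)).hasDerivAt h0
  have h2 := h1.smul (hasFDerivAt_id z)
  rw [show softTrunc M = truncWeight M • id from rfl, h2.fderiv]
  simp only [add_apply, smul_apply, ContinuousLinearMap.smulRight_apply, id,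
    ContinuousLinearMap.id_apply, innerSL_apply_apply, smul_eq_mul, nsmul_eq_mul, Nat.cast_ofNat]

/-- The derivative of the soft truncation is positive semidefinite for the real inner product, since
the truncation is `θ(|z|²) z` with `θ` nonnegative and increasing. -/
lemma re_fderiv_softTrunc_nonneg (M : ℝ) (z a : ℂ) :
    0 ≤ (inner ℂ (fderiv ℝ (softTrunc M) z a) a).re := by
  have h1 : (inner ℂ (fderiv ℝ (softTrunc M) z a) a).re =
      inner ℝ (fderiv ℝ (softTrunc M) z a) a := by simp [Complex.inner]
  have h2 : 0 ≤ deriv Real.smoothTransition (‖z‖ ^ 2 - M ^ 2) :=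
    Real.smoothTransition.monotone.deriv_nonneg
  rw [h1, fderiv_softTrunc, inner_add_left, real_inner_smul_left, real_inner_smul_left,
    real_inner_self_eq_norm_sq]
  have h3 := truncWeight_nonneg M z
  have h4 : deriv Real.smoothTransition (‖z‖ ^ 2 - M ^ 2) * (2 * inner ℝ z a) * inner ℝ z a =
    2 * (deriv Real.smoothTransition (‖z‖ ^ 2 - M ^ 2) * (inner ℝ z a) ^ 2) := by ring
  rw [h4]
  positivity

lemma exists_norm_fderiv_softTrunc_le (M : ℝ) : ∃ C : ℝ≥0, ∀ z, ‖fderiv ℝ (softTrunc M) z‖ ≤ C := by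
  have hc : Continuous (fderiv ℝ (softTrunc M)) :=
    (contDiff_softTrunc M).continuous_fderiv (by simp)
  obtain ⟨B, hB⟩ := (isCompact_closedBall (0 : ℂ) (|M| + 1)).exists_bound_of_continuousOn
    hc.continuousOn
  refine ⟨⟨max B 1, le_max_of_le_right zero_le_one⟩, fun z => ?_⟩
  by_cases hz : z ∈ Metric.closedBall (0 : ℂ) (|M| + 1)
  · exact (hB z hz).trans (le_max_left _ _)
  · have h1 : softTrunc M =ᶠ[𝓝 z] id := by
      filter_upwards [Metric.isClosed_closedBall.isOpen_compl.mem_nhds hz] with y hy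
      have hy' : |M| + 1 < ‖y‖ := by simpa using hy
      have : truncWeight M y = 1 := Real.smoothTransition.one_of_one_le (by
        nlinarith [abs_nonneg M, sq_abs M])
      simp [softTrunc, this]
    rw [h1.fderiv_eq, fderiv_id]
    exact ContinuousLinearMap.norm_id_le.trans (le_max_right _ _)

lemma exists_lipschitzWith_softTrunc (M : ℝ) : ∃ C : ℝ≥0, LipschitzWith C (softTrunc M) := by
  obtain ⟨C, hC⟩ := exists_norm_fderiv_softTrunc_le M
  exact ⟨C, lipschitzWith_of_nnnorm_fderiv_le
    ((contDiff_softTrunc M).differentiable (by simp)) hC⟩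

end Truncation

/-! ### `L^∞` contractions and duality -/

section Submarkov

open scoped InnerProductSpace
variable {α : Type*} [MeasurableSpace α] {μ : Measure α}

/-- Testing `c z = g` against the truncation of `z` at level `M`: the pointwise
inequality is strict where `|z| > M`. -/
lemma ae_norm_le_of_re_inner_softTrunc {M c : ℝ} (hM : 0 ≤ M) (hc : 0 < c) {z g w : Lp ℂ 2 μ}
    (hw : w =ᵐ[μ] fun x => softTrunc M (z x)) (hg : ∀ᵐ x ∂μ, ‖g x‖ ≤ c * M)
    (h : 0 ≤ (⟪w, g - (c : ℂ) • z⟫_ℂ).re) : ∀ᵐ x ∂μ, ‖z x‖ ≤ M := by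
  have hpt : ∀ᵐ x ∂μ, (⟪w x, (g - (c : ℂ) • z : Lp ℂ 2 μ) x⟫_ℂ).re ≤
      -(truncWeight M (z x) * ‖z x‖ * c * (‖z x‖ - M)) := by
    filter_upwards [hw, hg, Lp.coeFn_sub g ((c : ℂ) • z), Lp.coeFn_smul (c : ℂ) z]
      with x h1 h2 h3 h4
    rw [h1, h3, Pi.sub_apply, h4, Pi.smul_apply, softTrunc, inner_smul_left_eq_smul,
      inner_sub_right, inner_smul_right, inner_self_eq_norm_sq_to_K]
    have h5 : (⟪z x, g x⟫_ℂ).re ≤ ‖z x‖ * (c * M) :=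
      (Complex.re_le_norm _).trans ((norm_inner_le_norm _ _).trans
        (mul_le_mul_of_nonneg_left h2 (norm_nonneg _)))
    have h6 : (truncWeight M (z x) • (⟪z x, g x⟫_ℂ - (c : ℂ) * ((‖z x‖ : ℝ) : ℂ) ^ 2)).re =
        truncWeight M (z x) * ((⟪z x, g x⟫_ℂ).re - c * ‖z x‖ ^ 2) := by
      rw [Complex.smul_re, Complex.sub_re]
      norm_cast
    refine (le_of_eq h6).trans ?_
    have := mul_le_mul_of_nonneg_left h5 (truncWeight_nonneg M (z x))
    nlinarith
  have hint : Integrable (fun x => ⟪w x, (g - (c : ℂ) • z : Lp ℂ 2 μ) x⟫_ℂ) μ :=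
    L2.integrable_inner _ _
  have hle : ∀ᵐ x ∂μ, (⟪w x, (g - (c : ℂ) • z : Lp ℂ 2 μ) x⟫_ℂ).re ≤ 0 := by
    filter_upwards [hpt] with x hx
    refine hx.trans (neg_nonpos.2 ?_)
    rcases le_or_gt ‖z x‖ M with h1 | h1
    · simp [truncWeight_eq_zero h1]
    · have := truncWeight_nonneg M (z x)
      have := sub_pos.2 h1
      positivity
  have h0 : ∫ x, (⟪w x, (g - (c : ℂ) • z : Lp ℂ 2 μ) x⟫_ℂ).re ∂μ =
      (⟪w, g - (c : ℂ) • z⟫_ℂ).re := by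
    rw [L2.inner_def]; exact integral_re hint
  have hnn : 0 ≤ᵐ[μ] fun x => -(⟪w x, (g - (c : ℂ) • z : Lp ℂ 2 μ) x⟫_ℂ).re := by
    filter_upwards [hle] with x hx
    exact neg_nonneg.2 hx
  have hz : ∫ x, -(⟪w x, (g - (c : ℂ) • z : Lp ℂ 2 μ) x⟫_ℂ).re ∂μ = 0 := by
    refine le_antisymm ?_ (integral_nonneg_of_ae ?_)
    · rw [integral_neg, h0]; linarith
    · exact hnn
  have hz2 := (integral_eq_zero_iff_of_nonneg_ae hnn hint.re.neg).1 hz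
  filter_upwards [hz2, hpt] with x h1 h2
  by_contra! h3
  have h1 : -(⟪w x, (g - (c : ℂ) • z : Lp ℂ 2 μ) x⟫_ℂ).re = 0 := h1
  have h4 := truncWeight_pos hM h3
  have h5 := hM.trans_lt h3
  have h6 := sub_pos.2 h3
  have : 0 < truncWeight M (z x) * ‖z x‖ * c * (‖z x‖ - M) := by positivity
  linarith

/-- `T` does not increase `L^∞` bounds. -/
def IsLinftyContraction (T : Lp ℂ 2 μ →L[ℂ] Lp ℂ 2 μ) : Prop :=
  ∀ (u : Lp ℂ 2 μ) (M : ℝ), 0 < M → (∀ᵐ x ∂μ, ‖u x‖ ≤ M) → ∀ᵐ x ∂μ, ‖T u x‖ ≤ M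

lemma inner_toLp_left (z : Lp ℂ 2 μ) {f : α → ℂ} (hf : MemLp f 2 μ) :
    ⟪hf.toLp f, z⟫_ℂ = ∫ x, z x * starRingEnd ℂ (f x) ∂μ := by
  rw [L2.inner_def]
  refine integral_congr_ae ?_
  filter_upwards [hf.coeFn_toLp] with x hx
  rw [hx]; rfl

/-- A function of norm at most `M` as a functional on `L¹ ∩ L²` is bounded by `M`: otherwise test it
against its own restriction to `{M < |z|}`. -/
lemma ae_norm_le_of_forall_inner {z : Lp ℂ 2 μ} {M : ℝ} (hM : 0 < M)
    (h : ∀ w : Lp ℂ 2 μ, Integrable w μ → ‖⟪w, z⟫_ℂ‖ ≤ M * ∫ x, ‖w x‖ ∂μ) :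
    ∀ᵐ x ∂μ, ‖z x‖ ≤ M := by
  have hzm : Measurable z := (Lp.stronglyMeasurable z).measurable
  set B : Set α := {x | M < ‖z x‖} with hB
  have hBm : MeasurableSet B := measurableSet_lt measurable_const hzm.norm
  have hz2 : Integrable (fun x => ‖z x‖ ^ 2) μ := (Lp.memLp z).integrable_norm_pow two_ne_zero
  have hf : MemLp (B.indicator z) 2 μ := (Lp.memLp z).indicator hBm
  have hf1 : Integrable (B.indicator z) μ := by
    refine (hz2.const_mul M⁻¹).mono' (hzm.indicator hBm).aestronglyMeasurable
      (Eventually.of_forall fun x => ?_)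
    by_cases hx : x ∈ B
    · have hx' : M < ‖z x‖ := hx
      rw [Set.indicator_of_mem hx, ← div_eq_inv_mul, le_div_iff₀ hM]
      nlinarith [norm_nonneg (z x)]
    · rw [Set.indicator_of_notMem hx, norm_zero]; positivity
  have h1 := h (hf.toLp _) (hf1.congr hf.coeFn_toLp.symm)
  have h2 : ∫ x, ‖(hf.toLp _ : Lp ℂ 2 μ) x‖ ∂μ = ∫ x, B.indicator (fun x => ‖z x‖) x ∂μ := by
    refine integral_congr_ae ?_
    filter_upwards [hf.coeFn_toLp] with x hx
    rw [hx, norm_indicator_eq_indicator_norm]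
  have h3 : ∫ x, z x * starRingEnd ℂ (B.indicator z x) ∂μ =
      ((∫ x, B.indicator (fun x => ‖z x‖ ^ 2) x ∂μ : ℝ) : ℂ) := by
    rw [← integral_complex_ofReal]
    refine integral_congr_ae (Eventually.of_forall fun x => ?_)
    by_cases hx : x ∈ B
    · simp [Set.indicator_of_mem hx, Complex.mul_conj, Complex.normSq_eq_norm_sq]
    · simp [Set.indicator_of_notMem hx]
  rw [inner_toLp_left, h2, h3, Complex.norm_real] at h1
  have hi1 : Integrable (B.indicator fun x => ‖z x‖) μ := by
    refine hf1.norm.congr (Eventually.of_forall fun x => ?_)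
    simp only [norm_indicator_eq_indicator_norm]
  have hi2 : Integrable (B.indicator fun x => ‖z x‖ ^ 2) μ := hz2.indicator hBm
  have hnn : 0 ≤ᵐ[μ] fun x => B.indicator (fun x => ‖z x‖ ^ 2) x -
      M * B.indicator (fun x => ‖z x‖) x := by
    refine Eventually.of_forall fun x => ?_
    by_cases hx : x ∈ B
    · have hx' : M < ‖z x‖ := hx
      simp only [Set.indicator_of_mem hx, Pi.zero_apply]
      nlinarith [norm_nonneg (z x)]
    · simp [Set.indicator_of_notMem hx]
  have hint := hi2.sub (hi1.const_mul M)
  have hzero : ∫ x, (B.indicator (fun x => ‖z x‖ ^ 2) x - M * B.indicator (fun x => ‖z x‖) x) ∂μ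
      = 0 := by
    refine le_antisymm ?_ (integral_nonneg_of_ae hnn)
    rw [integral_sub hi2 (hi1.const_mul M), integral_const_mul]
    linarith [le_abs_self (∫ x, B.indicator (fun x => ‖z x‖ ^ 2) x ∂μ), Real.norm_eq_abs
      (∫ x, B.indicator (fun x => ‖z x‖ ^ 2) x ∂μ)]
  filter_upwards [(integral_eq_zero_iff_of_nonneg_ae hnn hint).1 hzero] with x hx
  by_contra! hlt
  have hxB : x ∈ B := hlt
  simp only [Set.indicator_of_mem hxB, Pi.zero_apply] at hx
  nlinarith [norm_nonneg (z x)]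

/-- By duality a self-adjoint operator that does not increase `L^∞` bounds preserves `L¹`. -/
lemma IsLinftyContraction.integrable [SigmaFinite μ] {T : Lp ℂ 2 μ →L[ℂ] Lp ℂ 2 μ}
    (hT : IsLinftyContraction T) (hsa : IsSelfAdjoint T) {u : Lp ℂ 2 μ} (hu : Integrable u μ) :
    Integrable (T u) μ := by
  set z := T u with hz
  have hzm : Measurable z := (Lp.stronglyMeasurable z).measurable
  refine integrable_of_forall_fin_meas_le (ENNReal.ofReal (∫ x, ‖u x‖ ∂μ)) ENNReal.ofReal_lt_top
    hzm.aestronglyMeasurable fun s hs hsf => ?_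
  -- the phase of `z` on `s`, with value `0` where `z` vanishes
  set f : α → ℂ := s.indicator fun x => z x / ‖z x‖ with hfdef
  have hfm : Measurable f := (hzm.div (by fun_prop)).indicator hs
  have hfb : ∀ x, ‖f x‖ ≤ s.indicator (fun _ => (1 : ℝ)) x := by
    intro x
    by_cases hx : x ∈ s
    · rw [hfdef, Set.indicator_of_mem hx, Set.indicator_of_mem hx, norm_div, Complex.norm_real,
        norm_norm]
      exact div_self_le_one _
    · simp [hfdef, Set.indicator_of_notMem hx]
  have hf : MemLp f 2 μ := by
    refine (memLp_indicator_const 2 hs (1 : ℝ) (Or.inr hsf)).mono hfm.aestronglyMeasurable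
      (Eventually.of_forall fun x => (hfb x).trans (le_abs_self _))
  have hfb1 : ∀ᵐ x ∂μ, ‖(hf.toLp f : Lp ℂ 2 μ) x‖ ≤ 1 := by
    filter_upwards [hf.coeFn_toLp] with x hx
    rw [hx]
    exact (hfb x).trans (Set.indicator_le_self' (fun _ _ => zero_le_one) x)
  have h1 : ‖⟪hf.toLp f, z⟫_ℂ‖ ≤ ∫ x, ‖u x‖ ∂μ := by
    have h2 : ⟪hf.toLp f, z⟫_ℂ = ⟪T (hf.toLp f), u⟫_ℂ := by
      rw [hz, ← ContinuousLinearMap.adjoint_inner_left, hsa.adjoint_eq]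
    rw [h2, L2.inner_def]
    refine norm_integral_le_of_norm_le hu.norm ?_
    filter_upwards [hT _ 1 one_pos hfb1] with x hx
    exact (norm_inner_le_norm _ _).trans (mul_le_of_le_one_left (norm_nonneg _) hx)
  have h3 : ⟪hf.toLp f, z⟫_ℂ = ((∫ x in s, ‖z x‖ ∂μ : ℝ) : ℂ) := by
    rw [inner_toLp_left, ← integral_complex_ofReal, ← integral_indicator hs]
    refine integral_congr_ae (Eventually.of_forall fun x => ?_)
    by_cases hx : x ∈ s
    · simp only [hfdef, Set.indicator_of_mem hx, map_div₀, Complex.conj_ofReal, mul_div_assoc',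
        Complex.mul_conj, Complex.normSq_eq_norm_sq]
      by_cases h0 : ‖z x‖ = 0
      · simp [h0]
      · have : ((‖z x‖ : ℝ) : ℂ) ≠ 0 := by exact_mod_cast h0
        push_cast
        field_simp
    · simp [hfdef, Set.indicator_of_notMem hx]
  rw [h3, Complex.norm_real, Real.norm_of_nonneg (integral_nonneg fun _ => norm_nonneg _)] at h1
  have hzs : IntegrableOn z s μ := by
    have : IsFiniteMeasure (μ.restrict s) := ⟨by simpa using hsf.lt_top⟩
    exact ((Lp.memLp z).restrict s).integrable (by norm_num)
  rw [← ofReal_integral_norm_eq_lintegral_enorm hzs]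
  exact ENNReal.ofReal_le_ofReal h1

lemma memLp_of_integrable_of_ae_bound {f : α → ℂ} (hf : Integrable f μ) {M : ℝ}
    (hM : ∀ᵐ x ∂μ, ‖f x‖ ≤ M) {p : ℝ} (hp : 1 ≤ p) : MemLp f (ENNReal.ofReal p) μ := by
  rw [← integrable_norm_rpow_iff hf.aestronglyMeasurable (by simp; linarith) ENNReal.ofReal_ne_top,
    ENNReal.toReal_ofReal (by linarith)]
  refine (hf.norm.const_mul (M ^ (p - 1))).mono'
    (hf.aestronglyMeasurable.norm.aemeasurable.pow_const p).aestronglyMeasurable ?_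
  filter_upwards [hM] with x hx
  rw [Real.norm_of_nonneg (by positivity)]
  calc ‖f x‖ ^ p = ‖f x‖ ^ (p - 1) * ‖f x‖ := by
        conv_lhs => rw [show p = (p - 1) + 1 by ring]
        rw [Real.rpow_add_one' (norm_nonneg _) (by linarith)]
    _ ≤ M ^ (p - 1) * ‖f x‖ := by
        gcongr

/-- The powers of `R` are averages of the operators `R (t + R)⁻¹`, so they inherit the
`L^∞` bounds of these. -/
lemma isLinftyContraction_opPow {R : Lp ℂ 2 μ →L[ℂ] Lp ℂ 2 μ} (hR : 0 ≤ R)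
    (hone : IsLinftyContraction R)
    (h : ∀ t : ℝ, 0 < t → ∀ (u y : Lp ℂ 2 μ) (M : ℝ), 0 < M → (t : ℂ) • y + R y = u →
      (∀ᵐ x ∂μ, ‖u x‖ ≤ M) → ∀ᵐ x ∂μ, ‖R y x‖ ≤ M / (1 + t))
    {s : ℝ} (hs : 0 < s) : IsLinftyContraction (opPow R s) := by
  have hfrac : ∀ s ∈ Set.Ioo (0 : ℝ) 1, IsLinftyContraction (opPow R s) := by
    intro s hs u M hM hu
    refine ae_norm_le_of_forall_inner hM fun w hw => ?_
    refine norm_inner_opPow_le hR hs fun t ht y hy => ?_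
    rw [L2.inner_def]
    refine (norm_integral_le_of_norm_le (hw.norm.mul_const (M / (1 + t))) ?_).trans_eq ?_
    · filter_upwards [h t ht u y M hM hy hu] with x hx
      exact (norm_inner_le_norm _ _).trans (mul_le_mul_of_nonneg_left hx (norm_nonneg _))
    · rw [integral_mul_const]; ring
  have key : ∀ (n : ℕ) (s : ℝ), (n : ℝ) < s → s ≤ n + 1 → IsLinftyContraction (opPow R s) := by
    intro n
    induction n with
    | zero =>
      intro s h0 h1
      rcases h1.lt_or_eq with h2 | h2
      · exact hfrac s ⟨by simpa using h0, by simpa using h2⟩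
      · rw [h2, Nat.cast_zero, zero_add, opPow_one hR]; exact hone
    | succ n ih =>
      intro s h0 h1
      rw [Nat.cast_succ] at h0 h1
      have hn : (0 : ℝ) ≤ n := n.cast_nonneg
      have := ih (s - 1) (by linarith) (by linarith)
      rw [show s = 1 + (s - 1) by ring, opPow_add hR one_pos (by linarith), opPow_one hR]
      exact fun u M hM hu => hone _ M hM (this u M hM hu)
  have hc : 1 ≤ ⌈s⌉₊ := Nat.one_le_ceil_iff.2 hs
  obtain ⟨n, hn⟩ := Nat.exists_eq_add_of_le' hc
  have h1 := Nat.ceil_lt_add_one hs.le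
  have h2 := Nat.le_ceil s
  rw [hn] at h1 h2
  push_cast at h1 h2
  exact key n s (by linarith) h2

end Submarkov

/-! ### Test functions and the Dirichlet form -/

section TestFunctions

open scoped InnerProductSpace
variable {E : Type*} [NormedAddCommGroup E] [NormedSpace ℝ E]
  {G : Type*} [TopologicalSpace G] [ChartedSpace E G] [Group G]

variable (E G) in
/-- The space `C_c^∞(G)` of complex-valued test functions. -/
def testSpace : Submodule ℂ (G → ℂ) where
  carrier := {φ | ContMDiff 𝓘(ℝ, E) 𝓘(ℝ, ℂ) ∞ φ ∧ HasCompactSupport φ}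
  add_mem' h₁ h₂ := ⟨h₁.1.add h₂.1, h₁.2.add h₂.2⟩
  zero_mem' := ⟨contMDiff_const, HasCompactSupport.zero⟩
  smul_mem' c _ h := ⟨((ContinuousLinearMap.mul ℝ ℂ) c).contMDiff.comp h.1, h.2.smul_left⟩

variable [LieGroup 𝓘(ℝ, E) ∞ G]

/-- A left-invariant vector field as an operator on test functions. -/
def lieTest (v : GroupLieAlgebra 𝓘(ℝ, E) G) : testSpace E G →ₗ[ℂ] testSpace E G where
  toFun φ := ⟨lieDeriv v φ, contMDiff_lieDeriv v φ.2.1, hasCompactSupport_lieDeriv v φ.2.2⟩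
  map_add' φ ψ := Subtype.ext (lieDeriv_add v φ.2.1 ψ.2.1)
  map_smul' c φ := Subtype.ext (lieDeriv_const_smul v φ.2.1 c)

/-- The operator `τ + Δ_χ` on test functions. -/
def shiftTest {l : ℕ} (X : Fin l → GroupLieAlgebra 𝓘(ℝ, E) G) (χ : G → ℝ) (τ : ℝ)
    (φ : testSpace E G) : testSpace E G :=
  (τ : ℂ) • φ - ∑ j, (lieTest (X j) (lieTest (X j) φ) +
    ((lieDeriv (X j) χ 1 : ℝ) : ℂ) • lieTest (X j) φ)

lemma coe_shiftTest {l : ℕ} (X : Fin l → GroupLieAlgebra 𝓘(ℝ, E) G) (χ : G → ℝ) (τ : ℝ)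
    (φ : testSpace E G) :
    (shiftTest X χ τ φ : G → ℂ) = fun x => τ * (φ : G → ℂ) x + driftLaplacian X χ φ x := by
  ext x
  have h : ∀ f : Fin l → testSpace E G, ((∑ j, f j : testSpace E G) : G → ℂ) x =
      ∑ j, (f j : G → ℂ) x := fun f => by rw [Submodule.coe_sum, Finset.sum_apply]
  rw [shiftTest, Submodule.coe_sub, Pi.sub_apply, h]
  simp only [driftLaplacian, Submodule.coe_add,
    Submodule.coe_smul, Pi.smul_apply, Pi.add_apply, smul_eq_mul,
    sub_eq_add_neg, lieTest, LinearMap.coe_mk, AddHom.coe_mk, Complex.real_smul]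

variable [MeasurableSpace G] [BorelSpace G]

section Embedding

variable (μ : Measure G) [IsFiniteMeasureOnCompacts μ]

omit [Group G] [LieGroup 𝓘(ℝ, E) ∞ G] in
lemma memLp_testSpace (φ : testSpace E G) (p : ℝ≥0∞) : MemLp (φ : G → ℂ) p μ :=
  φ.2.1.continuous.memLp_of_hasCompactSupport φ.2.2

/-- The inclusion of the test functions in `L²(μ)`. -/
def toL2 : testSpace E G →ₗ[ℂ] Lp ℂ 2 μ where
  toFun φ := (memLp_testSpace μ φ 2).toLp φ
  map_add' _ _ := MemLp.toLp_add _ _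
  map_smul' c _ := MemLp.toLp_const_smul c _

omit [Group G] [LieGroup 𝓘(ℝ, E) ∞ G] in
lemma coeFn_toL2 (φ : testSpace E G) : toL2 μ φ =ᵐ[μ] (φ : G → ℂ) :=
  (memLp_testSpace μ φ 2).coeFn_toLp

omit [Group G] [LieGroup 𝓘(ℝ, E) ∞ G] in
lemma inner_toL2 (φ ψ : testSpace E G) :
    ⟪toL2 μ ψ, toL2 μ φ⟫_ℂ =
      ∫ x, starRingEnd ℂ ((ψ : G → ℂ) x) * (φ : G → ℂ) x ∂μ := by
  rw [L2.inner_def]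
  refine integral_congr_ae ?_
  filter_upwards [coeFn_toL2 μ φ, coeFn_toL2 μ ψ] with x h1 h2
  rw [h1, h2]
  exact mul_comm _ _

/-- The horizontal gradient `φ ↦ (X_j φ)_j` with values in `L²(μ)`. -/
def gradL2 {l : ℕ} (X : Fin l → GroupLieAlgebra 𝓘(ℝ, E) G) :
    testSpace E G →ₗ[ℂ] PiLp 2 (fun _ : Fin l => Lp ℂ 2 μ) :=
  (WithLp.linearEquiv 2 ℂ (Fin l → Lp ℂ 2 μ)).symm.toLinearMap ∘ₗ
    LinearMap.pi fun j => toL2 μ ∘ₗ lieTest (X j)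

lemma gradL2_apply {l : ℕ} (X : Fin l → GroupLieAlgebra 𝓘(ℝ, E) G) (φ : testSpace E G)
    (j : Fin l) : gradL2 μ X φ j = toL2 μ (lieTest (X j) φ) := rfl

end Embedding

/-- Composition of a test function with the soft truncation. -/
def truncTest (M : ℝ) (φ : testSpace E G) : testSpace E G :=
  ⟨fun x => softTrunc M ((φ : G → ℂ) x), (contDiff_softTrunc M).contMDiff.comp φ.2.1,
    φ.2.2.comp_left (softTrunc_zero M)⟩

/-- The truncation is bounded on the form domain. It need not be continuous there, and boundedness
is enough for passing to the limit in `re_inner_softTrunc_nonneg`. -/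
lemma norm_toL2_lieTest_truncTest_le (μ : Measure G) [IsFiniteMeasureOnCompacts μ] {M : ℝ}
    {C : ℝ≥0} (hC : ∀ z, ‖fderiv ℝ (softTrunc M) z‖ ≤ C) (v : GroupLieAlgebra 𝓘(ℝ, E) G)
    (φ : testSpace E G) :
    ‖toL2 μ (lieTest v (truncTest M φ))‖ ≤ C * ‖toL2 μ (lieTest v φ)‖ := by
  refine Lp.norm_le_mul_norm_of_ae_le_mul ?_
  filter_upwards [coeFn_toL2 μ (lieTest v (truncTest M φ)), coeFn_toL2 μ (lieTest v φ)] with x h1 h2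
  rw [h1, h2]
  change ‖lieDeriv v (fun y => softTrunc M ((φ : G → ℂ) y)) x‖ ≤ _
  rw [lieDeriv_comp v φ.2.1 (contDiff_softTrunc M)]
  exact (ContinuousLinearMap.le_opNorm _ _).trans
    (mul_le_mul_of_nonneg_right (hC _) (norm_nonneg _))

lemma re_inner_lieTest_truncTest_nonneg (μ : Measure G) [IsFiniteMeasureOnCompacts μ] (M : ℝ)
    (v : GroupLieAlgebra 𝓘(ℝ, E) G) (φ : testSpace E G) :
    0 ≤ (⟪toL2 μ (lieTest v (truncTest M φ)), toL2 μ (lieTest v φ)⟫_ℂ).re := by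
  have hint := L2.integrable_inner (𝕜 := ℂ) (toL2 μ (lieTest v (truncTest M φ)))
    (toL2 μ (lieTest v φ))
  rw [L2.inner_def]
  refine le_of_le_of_eq (integral_nonneg_of_ae ?_) (integral_re hint)
  filter_upwards [coeFn_toL2 μ (lieTest v (truncTest M φ)), coeFn_toL2 μ (lieTest v φ)] with x h1 h2
  rw [h1, h2]
  have h3 : (lieTest v (truncTest M φ) : G → ℂ) x =
    fderiv ℝ (softTrunc M) ((φ : G → ℂ) x) (lieDeriv v φ x) :=
      lieDeriv_comp v φ.2.1 (contDiff_softTrunc M) x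
  rw [h3]
  exact re_fderiv_softTrunc_nonneg M _ _

/-- The truncation of a solution `z` of the weak equation `τ z + Δ z = y` is an admissible test
function, and the Dirichlet form of `z` with its truncation is nonnegative. -/
lemma re_inner_softTrunc_nonneg (μ : Measure G) [IsFiniteMeasureOnCompacts μ] {l : ℕ}
    (X : Fin l → GroupLieAlgebra 𝓘(ℝ, E) G) {τ : ℝ} {y z : Lp ℂ 2 μ}
    {k : PiLp 2 (fun _ : Fin l => Lp ℂ 2 μ)} {φ : ℕ → testSpace E G}
    (hz : Tendsto (fun n => toL2 μ (φ n)) atTop (𝓝 z))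
    (hk : Tendsto (fun n => gradL2 μ X (φ n)) atTop (𝓝 k))
    (hweak : ∀ ψ, τ * ⟪toL2 μ ψ, z⟫_ℂ + ⟪gradL2 μ X ψ, k⟫_ℂ = ⟪toL2 μ ψ, y⟫_ℂ) (M : ℝ) :
    ∃ w : Lp ℂ 2 μ, w =ᵐ[μ] (fun x => softTrunc M (z x)) ∧
      0 ≤ (⟪w, y - (τ : ℂ) • z⟫_ℂ).re := by
  obtain ⟨C, hC⟩ := exists_norm_fderiv_softTrunc_le M
  obtain ⟨C', hC'⟩ := exists_lipschitzWith_softTrunc M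
  refine ⟨hC'.compLp (softTrunc_zero M) z, hC'.coeFn_compLp _ z, ?_⟩
  -- approximate `z` by test functions and truncate these; the error terms tend to `0` because the
  -- truncated gradients stay bounded
  have htr : ∀ n, hC'.compLp (softTrunc_zero M) (toL2 μ (φ n)) = toL2 μ (truncTest M (φ n)) := by
    intro n
    refine Lp.ext ?_
    filter_upwards [hC'.coeFn_compLp (softTrunc_zero M) (toL2 μ (φ n)), coeFn_toL2 μ (φ n),
      coeFn_toL2 μ (truncTest M (φ n))] with x h1 h2 h3
    rw [h1, h3, Function.comp_apply, h2]
    rfl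
  have hw : Tendsto (fun n => toL2 μ (truncTest M (φ n))) atTop
      (𝓝 (hC'.compLp (softTrunc_zero M) z)) := by
    simp_rw [← htr]
    exact ((hC'.continuous_compLp (softTrunc_zero M)).tendsto z).comp hz
  have hlim : Tendsto (fun n => (⟪toL2 μ (truncTest M (φ n)), y - (τ : ℂ) • z⟫_ℂ).re) atTop
      (𝓝 (⟪hC'.compLp (softTrunc_zero M) z, y - (τ : ℂ) • z⟫_ℂ).re) :=
    (Complex.continuous_re.tendsto _).comp (hw.inner tendsto_const_nhds)
  have heq : ∀ n, ⟪toL2 μ (truncTest M (φ n)), y - (τ : ℂ) • z⟫_ℂ =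
      ∑ j, (⟪toL2 μ (lieTest (X j) (truncTest M (φ n))), toL2 μ (lieTest (X j) (φ n))⟫_ℂ +
        ⟪toL2 μ (lieTest (X j) (truncTest M (φ n))), k j - toL2 μ (lieTest (X j) (φ n))⟫_ℂ) := by
    intro n
    have h1 := hweak (truncTest M (φ n))
    rw [PiLp.inner_apply] at h1
    rw [inner_sub_right, inner_smul_right, ← h1]
    simp only [← inner_add_right, add_sub_cancel, gradL2_apply]
    ring
  have hj : ∀ j, Tendsto (fun n => toL2 μ (lieTest (X j) (φ n))) atTop (𝓝 (k j)) := fun j =>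
    ((PiLp.continuous_apply 2 _ j).tendsto k).comp hk
  have herr : Tendsto (fun n => ∑ j, -(C * ‖toL2 μ (lieTest (X j) (φ n))‖ *
      ‖k j - toL2 μ (lieTest (X j) (φ n))‖)) atTop (𝓝 0) := by
    have h0 : (0 : ℝ) = ∑ j, -(C * ‖k j‖ * ‖k j - k j‖) := by simp
    rw [h0]
    refine tendsto_finsetSum _ fun j _ => ?_
    exact (((hj j).norm.const_mul _).mul ((tendsto_const_nhds.sub (hj j)).norm)).neg
  refine le_of_tendsto_of_tendsto' herr hlim fun n => ?_
  rw [heq, Complex.re_sum]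
  refine Finset.sum_le_sum fun j _ => ?_
  rw [Complex.add_re]
  have h1 := re_inner_lieTest_truncTest_nonneg μ M (X j) (φ n)
  have h2 := norm_inner_le_norm (𝕜 := ℂ) (toL2 μ (lieTest (X j) (truncTest M (φ n))))
    (k j - toL2 μ (lieTest (X j) (φ n)))
  have h3 := mul_le_mul_of_nonneg_right
    (norm_toL2_lieTest_truncTest_le μ hC (X j) (φ n))
    (norm_nonneg (k j - toL2 μ (lieTest (X j) (φ n))))
  have h4 := Complex.abs_re_le_norm (⟪toL2 μ (lieTest (X j) (truncTest M (φ n))),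
    k j - toL2 μ (lieTest (X j) (φ n))⟫_ℂ)
  have h5 := neg_abs_le (⟪toL2 μ (lieTest (X j) (truncTest M (φ n))),
    k j - toL2 μ (lieTest (X j) (φ n))⟫_ℂ).re
  linarith

variable [FiniteDimensional ℝ E] [IsTopologicalGroup G] [T2Space G] [SecondCountableTopology G]
  [LocallyCompactSpace G] (lam : Measure G) [lam.IsHaarMeasure]
  {χ : G →* ℝ}

/-- Integration by parts: `X_j + (X_j χ)(e)` is minus the adjoint of `X_j` in `L²(μ_χ)`. -/
lemma inner_lieTest [IsFiniteMeasureOnCompacts (muChi lam χ)] (hχ : Continuous χ)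
    (hpos : ∀ x, 0 < χ x) (v : GroupLieAlgebra 𝓘(ℝ, E) G) (φ ψ : testSpace E G) :
    ⟪toL2 (muChi lam χ) ψ, toL2 (muChi lam χ) (lieTest v φ)⟫_ℂ +
      ((lieDeriv v χ 1 : ℝ) : ℂ) * ⟪toL2 (muChi lam χ) ψ, toL2 (muChi lam χ) φ⟫_ℂ =
    -⟪toL2 (muChi lam χ) (lieTest v ψ), toL2 (muChi lam χ) φ⟫_ℂ := by
  simp only [inner_toL2]
  have hsm : ContMDiff 𝓘(ℝ, E) 𝓘(ℝ, ℂ) ∞ fun y =>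
      starRingEnd ℂ ((ψ : G → ℂ) y) * (φ : G → ℂ) y :=
    contDiff_mul.contMDiff.comp
      ((Complex.conjCLE.contDiff.contMDiff.comp ψ.2.1).prodMk_space φ.2.1)
  have h := integral_lieDeriv lam hχ hpos hsm φ.2.2.mul_left v
  have hint : ∀ a c : testSpace E G, Integrable
      (fun x => starRingEnd ℂ ((a : G → ℂ) x) * (c : G → ℂ) x) (muChi lam χ) := fun a c =>
    ((Complex.continuous_conj.comp a.2.1.continuous).mul
      c.2.1.continuous).integrable_of_hasCompactSupport c.2.2.mul_left
  have h2 : ∀ x, lieDeriv v (fun y => starRingEnd ℂ ((ψ : G → ℂ) y) * (φ : G → ℂ) y) x =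
      starRingEnd ℂ ((lieTest v ψ : G → ℂ) x) * (φ : G → ℂ) x +
        starRingEnd ℂ ((ψ : G → ℂ) x) * (lieTest v φ : G → ℂ) x :=
    lieDeriv_conj_mul v φ.2.1 ψ.2.1
  simp_rw [h2] at h
  rw [integral_add (hint (lieTest v ψ) φ) (hint ψ (lieTest v φ)), Complex.real_smul] at h
  linear_combination h

/-- `τ + Δ_χ` is the operator of the form `τ ⟨ψ, φ⟩ + ∑ j, ⟨X_j ψ, X_j φ⟩` on `L²(μ_χ)`. -/
lemma inner_shiftTest [IsFiniteMeasureOnCompacts (muChi lam χ)] (hχ : Continuous χ)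
    (hpos : ∀ x, 0 < χ x) {l : ℕ} (X : Fin l → GroupLieAlgebra 𝓘(ℝ, E) G) (τ : ℝ)
    (φ ψ : testSpace E G) :
    ⟪toL2 (muChi lam χ) ψ, toL2 (muChi lam χ) (shiftTest X χ τ φ)⟫_ℂ =
      τ * ⟪toL2 (muChi lam χ) ψ, toL2 (muChi lam χ) φ⟫_ℂ +
        ⟪gradL2 (muChi lam χ) X ψ, gradL2 (muChi lam χ) X φ⟫_ℂ := by
  rw [shiftTest, map_sub, map_sum, inner_sub_right, map_smul, inner_smul_right, inner_sum,
    sub_eq_add_neg, ← Finset.sum_neg_distrib, PiLp.inner_apply]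
  congr 1
  refine Finset.sum_congr rfl fun j _ => ?_
  rw [map_add, map_smul, inner_add_right, inner_smul_right, inner_lieTest lam hχ hpos, neg_neg]
  rfl

/-- The resolvent `(τ + Δ_χ)⁻¹` of the closure of the form `∑ j, ⟨X_j ψ, X_j φ⟩` is positive, and
its powers are contractions for the `L^∞` norm. -/
theorem exists_resolvent (hχ : Continuous χ) (hpos : ∀ x, 0 < χ x) {l : ℕ}
    (X : Fin l → GroupLieAlgebra 𝓘(ℝ, E) G) {τ : ℝ} (hτ : 1 ≤ τ) :
    ∃ R : Lp ℂ 2 (muChi lam χ) →L[ℂ] Lp ℂ 2 (muChi lam χ), 0 ≤ R ∧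
      IsResolvent X χ (muChi lam χ) τ R ∧ ∀ s > 0, IsLinftyContraction (opPow R s) := by
  have := isLocallyFiniteMeasure_muChi lam hχ
  set μ := muChi lam χ with hμ
  obtain ⟨R, hR, hA, hweak⟩ := exists_form_resolvent (toL2 μ) (gradL2 μ X)
    (fun φ => toL2 μ (shiftTest X χ τ φ)) (by linarith : 0 < τ) (inner_shiftTest lam hχ hpos X τ)
  have htr : ∀ (y : Lp ℂ 2 μ) (M : ℝ), ∃ w : Lp ℂ 2 μ,
      w =ᵐ[μ] (fun x => softTrunc M (R y x)) ∧ 0 ≤ (⟪w, y - (τ : ℂ) • R y⟫_ℂ).re := by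
    intro y M
    obtain ⟨k, φ, h1, h2, h3⟩ := hweak y
    exact re_inner_softTrunc_nonneg μ X h1 h2 h3 M
  refine ⟨R, hR, ⟨hR.isSelfAdjoint, ?_⟩, fun s hs => isLinftyContraction_opPow hR ?_ ?_ hs⟩
  · intro φ hφ hc u w hu hw
    have h1 : u = toL2 μ (⟨φ, hφ, hc⟩ : testSpace E G) :=
      Lp.ext (hu.trans (coeFn_toL2 μ (⟨φ, hφ, hc⟩ : testSpace E G)).symm)
    have h2 : w = toL2 μ (shiftTest X χ τ (⟨φ, hφ, hc⟩ : testSpace E G)) := by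
      refine Lp.ext (hw.trans ?_)
      have h3 := coeFn_toL2 μ (shiftTest X χ τ (⟨φ, hφ, hc⟩ : testSpace E G))
      rw [coe_shiftTest] at h3
      exact h3.symm
    rw [h1, h2, hA]
  · intro u M hM hu
    obtain ⟨w, hw, h0⟩ := htr u M
    refine ae_norm_le_of_re_inner_softTrunc hM.le (by linarith) hw ?_ h0
    filter_upwards [hu] with x hx
    nlinarith
  · intro t ht u y M hM hy hu
    obtain ⟨w, hw, h0⟩ := htr y (M / (1 + t))
    refine ae_norm_le_of_re_inner_softTrunc (c := 1 + t * τ) (g := u) (by positivity)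
      (by positivity) hw ?_ ?_
    · filter_upwards [hu] with x hx
      refine hx.trans ?_
      rw [← mul_div_assoc, le_div_iff₀ (by positivity)]
      nlinarith [mul_nonneg (mul_pos ht hM).le (sub_nonneg.2 hτ)]
    -- `y = (τ + Δ) z` and `u = t y + z` for `z = R y`, whence `u - (1 + t τ) z = t Δ z`
    · have h1 : u - ((1 + t * τ : ℝ) : ℂ) • R y = (t : ℂ) • (y - (τ : ℂ) • R y) := by
        rw [← hy]; push_cast; module
      rw [h1, inner_smul_right, Complex.re_ofReal_mul]
      exact mul_nonneg ht.le h0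

end TestFunctions

/-! ### A nonzero function in every Sobolev space -/

section FracPower

variable {E : Type*} [NormedAddCommGroup E] [NormedSpace ℝ E]
  {G : Type*} [TopologicalSpace G] [ChartedSpace E G] [Group G] [MeasurableSpace G]

/-- An element of `L² ∩ L^p` needs no approximation: its image under `R ^ s` is its fractional
power as soon as it lies in `L^p`. -/
lemma isFracPower_opPow {l : ℕ} {X : Fin l → GroupLieAlgebra 𝓘(ℝ, E) G} {χ : G → ℝ}
    {μ : Measure G} {τ s : ℝ} {p : ℝ≥0∞} {R : Lp ℂ 2 μ →L[ℂ] Lp ℂ 2 μ}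
    (hR : IsResolvent X χ μ τ R) {v : Lp ℂ 2 μ} (hv : MemLp v p μ)
    (hf : MemLp (opPow R s v) p μ) : IsFracPower X χ μ τ s p (opPow R s v) v :=
  ⟨hf, hv, R, hR, fun _ => v, by simp, by simp⟩

end FracPower

section NonzeroPair

variable {E : Type*} [NormedAddCommGroup E] [NormedSpace ℝ E] [FiniteDimensional ℝ E]
  {G : Type*} [TopologicalSpace G] [ChartedSpace E G] [Group G] [LieGroup 𝓘(ℝ, E) ∞ G]
  [MeasurableSpace G] [BorelSpace G] [IsTopologicalGroup G] [T2Space G]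
  [SecondCountableTopology G] [LocallyCompactSpace G] (lam : Measure G) [lam.IsHaarMeasure]
  {χ : G →* ℝ}

/-- There is a function `f = (τ + Δ_χ)^{-s} g ≠ 0` with `f, g ∈ L^p`. For `g` one takes
`(τ + Δ_χ)^k φ` with a test function `φ` and an integer `k > s`; it is a test function, hence in
`L¹ ∩ L^∞`, and so is `f`. -/
theorem exists_isFracPower_ne_zero (hχ : Continuous χ) (hpos : ∀ x, 0 < χ x) {l : ℕ}
    (X : Fin l → GroupLieAlgebra 𝓘(ℝ, E) G) {τ : ℝ} (hτ : 1 ≤ τ) {s : ℝ} (hs : 0 < s)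
    {p : ℝ} (hp : 1 ≤ p) :
    ∃ f g : G → ℂ, IsFracPower X χ (muChi lam χ) τ s (ENNReal.ofReal p) f g ∧ Measurable f ∧
      ¬ f =ᵐ[muChi lam χ] 0 := by
  have := isLocallyFiniteMeasure_muChi lam hχ
  have := isOpenPosMeasure_muChi lam hχ hpos
  set μ := muChi lam χ
  obtain ⟨R, hR, hres, hcontr⟩ := exists_resolvent lam hχ hpos X hτ
  obtain ⟨φ, hφ, hc, -, h1⟩ := exists_bump E G
  let φ₀ : testSpace E G := ⟨fun x => (φ x : ℂ), Complex.ofRealCLM.contDiff.contMDiff.comp hφ,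
    hc.comp_left Complex.ofReal_zero⟩
  have hφ₀ : toL2 μ φ₀ ≠ 0 := by
    intro h0
    have h2 : (φ₀ : G → ℂ) =ᵐ[μ] 0 := by
      filter_upwards [coeFn_toL2 μ φ₀, Lp.coeFn_zero ℂ 2 μ] with x hx hx'
      rw [← hx, h0, hx']
    have h3 := congrFun (φ₀.2.1.continuous.ae_eq_iff_eq μ continuous_zero |>.1 h2) 1
    have h4 : (φ₀ : G → ℂ) 1 = 1 := by simp [φ₀, h1]
    rw [h4] at h3
    exact one_ne_zero h3
  have hA : ∀ ψ : testSpace E G, R (toL2 μ (shiftTest X χ τ ψ)) = toL2 μ ψ := fun ψ =>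
    hres.leftInverse ψ ψ.2.1 ψ.2.2 _ _ (coeFn_toL2 μ ψ)
      (by rw [← coe_shiftTest]; exact coeFn_toL2 μ _)
  have hpow : ∀ k : ℕ, (R ^ k) (toL2 μ ((shiftTest X χ τ)^[k] φ₀)) = toL2 μ φ₀ := by
    intro k
    induction k with
    | zero => simp
    | succ k ih =>
      rw [Function.iterate_succ_apply', pow_succ, mul_apply_eq_comp, hA, ih]
  -- an integer larger than `s`, so that `R ^ k` factors through `R ^ s`
  set k := ⌈s⌉₊ + 1 with hk
  have hsk : s < k := by
    have := Nat.le_ceil s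
    push_cast [hk]; linarith
  set v : testSpace E G := (shiftTest X χ τ)^[k] φ₀ with hv
  have hne : opPow R s (toL2 μ v) ≠ 0 := by
    intro h0
    apply hφ₀
    rw [← hpow k, hk, ← opPow_natCast_succ hR, ← hk,
      show (k : ℝ) = (k - s) + s by ring, opPow_add hR (sub_pos.2 hsk) hs,
      mul_apply_eq_comp, h0, map_zero]
  have hint : Integrable (toL2 μ v) μ :=
    (memLp_one_iff_integrable.1 (memLp_testSpace μ v 1)).congr (coeFn_toL2 μ v).symm
  obtain ⟨B, hB⟩ := v.2.1.continuous.bounded_above_of_compact_support v.2.2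
  have hbd : ∀ᵐ x ∂μ, ‖toL2 μ v x‖ ≤ max B 1 := by
    filter_upwards [coeFn_toL2 μ v] with x hx
    rw [hx]; exact (hB x).trans (le_max_left _ _)
  have hcs := hcontr s hs
  have hsa : IsSelfAdjoint (opPow R s) := cfc_predicate _ _
  have hf : MemLp (opPow R s (toL2 μ v)) (ENNReal.ofReal p) μ :=
    memLp_of_integrable_of_ae_bound (hcs.integrable hsa hint)
      (hcs _ _ (lt_max_of_lt_right one_pos) hbd) hp
  refine ⟨_, _, isFracPower_opPow hres
    ((memLp_testSpace μ v _).ae_eq (coeFn_toL2 μ v).symm) hf,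
    (Lp.stronglyMeasurable _).measurable, fun h0 => hne (Lp.ext (h0.trans ?_))⟩
  exact (Lp.coeFn_zero ℂ 2 μ).symm

end NonzeroPair

/-! ### Translations on `L^p` -/

section Translation

variable {G : Type*} [TopologicalSpace G] [Group G]
  [MeasurableSpace G] [BorelSpace G] [IsTopologicalGroup G]
  {μ : Measure G} {y : G} {c : ℝ}

lemma map_inv_mul_of_map_mul (hc : 0 < c) (h : μ.map (y * ·) = ENNReal.ofReal c • μ) :
    μ.map (y⁻¹ * ·) = ENNReal.ofReal c⁻¹ • μ := by
  have h1 : μ = ENNReal.ofReal c • μ.map (y⁻¹ * ·) := by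
    rw [← Measure.map_smul, ← h, Measure.map_map (by fun_prop) (by fun_prop)]
    simp [Function.comp_def]
  conv_rhs => rw [h1]
  rw [smul_smul, ← ENNReal.ofReal_mul (inv_nonneg.2 hc.le), inv_mul_cancel₀ hc.ne',
    ENNReal.ofReal_one, one_smul]

lemma quasiMeasurePreserving_mul_left_of_map (h : μ.map (y * ·) = ENNReal.ofReal c • μ) :
    Measure.QuasiMeasurePreserving (y * ·) μ μ :=
  ⟨by fun_prop, h ▸ Measure.smul_absolutelyContinuous⟩

lemma aestronglyMeasurable_comp_mul_left (h : μ.map (y * ·) = ENNReal.ofReal c • μ) {f : G → ℂ}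
    (hf : AEStronglyMeasurable f μ) : AEStronglyMeasurable (fun x => f (y * x)) μ :=
  hf.comp_quasiMeasurePreserving (quasiMeasurePreserving_mul_left_of_map h)

lemma eLpNorm_comp_mul_left (h : μ.map (y * ·) = ENNReal.ofReal c • μ)
    {p : ℝ≥0∞} (hp : p ≠ ⊤) {f : G → ℂ} (hf : AEStronglyMeasurable f μ) :
    eLpNorm (fun x => f (y * x)) p μ = ENNReal.ofReal c ^ (1 / p.toReal) * eLpNorm f p μ := by
  have h1 : eLpNorm (f ∘ (y * ·)) p μ = eLpNorm f p (μ.map (y * ·)) :=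
    (eLpNorm_map_measure (by rw [h]; exact hf.smul_measure _) (by fun_prop)).symm
  rw [show (fun x => f (y * x)) = f ∘ (y * ·) from rfl, h1, h,
    eLpNorm_smul_measure_of_ne_top hp, smul_eq_mul, ENNReal.toReal_div, ENNReal.toReal_one]

lemma memLp_comp_mul_left (h : μ.map (y * ·) = ENNReal.ofReal c • μ)
    {p : ℝ≥0∞} (hp : p ≠ ⊤) {f : G → ℂ} (hf : MemLp f p μ) :
    MemLp (fun x => f (y * x)) p μ :=
  ⟨aestronglyMeasurable_comp_mul_left h hf.1, by
    rw [eLpNorm_comp_mul_left h hp hf.1]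
    exact ENNReal.mul_lt_top (ENNReal.rpow_lt_top_of_nonneg (by positivity) ENNReal.ofReal_ne_top)
      hf.2⟩

/-- Left translation in `L²(μ)`, normalised to be isometric when it multiplies `μ` by `c`. -/
def translateLp (h : μ.map (y * ·) = ENNReal.ofReal c • μ) (u : Lp ℂ 2 μ) : Lp ℂ 2 μ :=
  ((memLp_comp_mul_left h ENNReal.ofNat_ne_top (Lp.memLp u)).const_smul (((√c)⁻¹ : ℝ) : ℂ)).toLp

lemma coeFn_translateLp (h : μ.map (y * ·) = ENNReal.ofReal c • μ) (u : Lp ℂ 2 μ) :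
    translateLp h u =ᵐ[μ] fun x => (((√c)⁻¹ : ℝ) : ℂ) * u (y * x) :=
  MemLp.coeFn_toLp ((memLp_comp_mul_left h ENNReal.ofNat_ne_top (Lp.memLp u)).const_smul
    (((√c)⁻¹ : ℝ) : ℂ))

/-- `translateLp` as a linear isometry. -/
def translateIsometry (hc : 0 < c) (h : μ.map (y * ·) = ENNReal.ofReal c • μ) :
    Lp ℂ 2 μ →ₗᵢ[ℂ] Lp ℂ 2 μ where
  toFun := translateLp h
  map_add' u w := by
    refine Lp.ext ?_
    filter_upwards [coeFn_translateLp h (u + w), coeFn_translateLp h u, coeFn_translateLp h w,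
      (quasiMeasurePreserving_mul_left_of_map h).ae (Lp.coeFn_add u w),
      Lp.coeFn_add (translateLp h u) (translateLp h w)] with x h1 h2 h3 h4 h5
    rw [h1, h5, Pi.add_apply, h2, h3, h4, Pi.add_apply, mul_add]
  map_smul' k u := by
    refine Lp.ext ?_
    filter_upwards [coeFn_translateLp h (k • u), coeFn_translateLp h u,
      (quasiMeasurePreserving_mul_left_of_map h).ae (Lp.coeFn_smul k u),
      Lp.coeFn_smul k (translateLp h u)] with x h1 h2 h3 h4
    rw [h1, RingHom.id_apply, h4, Pi.smul_apply, h2, h3, Pi.smul_apply, smul_eq_mul, smul_eq_mul]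
    ring
  norm_map' u := by
    change ‖translateLp h u‖ = ‖u‖
    have hs : 0 < √c := Real.sqrt_pos.2 hc
    rw [translateLp, Lp.norm_toLp, eLpNorm_const_smul, eLpNorm_comp_mul_left h ENNReal.ofNat_ne_top
      (Lp.memLp u).1, Lp.norm_def, ← mul_assoc]
    have h1 : ‖(((√c)⁻¹ : ℝ) : ℂ)‖ₑ * ENNReal.ofReal c ^ (1 / (2 : ℝ≥0∞).toReal) = 1 := by
      rw [ENNReal.toReal_ofNat, ENNReal.ofReal_rpow_of_pos hc, ← Real.sqrt_eq_rpow,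
        ← ofReal_norm, Complex.norm_real, Real.norm_of_nonneg (inv_nonneg.2 hs.le),
        ← ENNReal.ofReal_mul (inv_nonneg.2 hs.le), inv_mul_cancel₀ hs.ne', ENNReal.ofReal_one]
    rw [h1, one_mul]

lemma coeFn_translateIsometry (hc : 0 < c) (h : μ.map (y * ·) = ENNReal.ofReal c • μ)
    (u : Lp ℂ 2 μ) :
    translateIsometry hc h u =ᵐ[μ] fun x => (((√c)⁻¹ : ℝ) : ℂ) * u (y * x) :=
  coeFn_translateLp h u

lemma translateIsometry_surjective (hc : 0 < c) (h : μ.map (y * ·) = ENNReal.ofReal c • μ) :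
    Function.Surjective (translateIsometry hc h) := by
  intro w
  refine ⟨translateIsometry (inv_pos.2 hc) (map_inv_mul_of_map_mul hc h) w, Lp.ext ?_⟩
  filter_upwards [coeFn_translateIsometry hc h
      (translateIsometry (inv_pos.2 hc) (map_inv_mul_of_map_mul hc h) w),
    (quasiMeasurePreserving_mul_left_of_map h).ae
      (coeFn_translateIsometry (inv_pos.2 hc) (map_inv_mul_of_map_mul hc h) w)] with x h1 h2
  have hs : 0 < √c := Real.sqrt_pos.2 hc
  rw [h1, h2, ← mul_assoc, ← Complex.ofReal_mul, Real.sqrt_inv, inv_inv, inv_mul_cancel₀ hs.ne']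
  norm_num

/-- `translateIsometry` as a unitary operator. -/
def translateEquiv (hc : 0 < c) (h : μ.map (y * ·) = ENNReal.ofReal c • μ) :
    Lp ℂ 2 μ ≃ₗᵢ[ℂ] Lp ℂ 2 μ :=
  LinearIsometryEquiv.ofSurjective _ (translateIsometry_surjective hc h)

/-- The powers of an operator are compatible with unitary equivalence. -/
lemma opPow_conj {H : Type*} [NormedAddCommGroup H] [InnerProductSpace ℂ H] [CompleteSpace H]
    (U : H ≃ₗᵢ[ℂ] H) {R : H →L[ℂ] H} (hR : IsSelfAdjoint R) {s : ℝ} (hs : 0 < s) :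
    opPow (U.conjStarAlgEquiv R) s = U.conjStarAlgEquiv (opPow R s) := by
  refine (StarAlgHomClass.map_cfc (S := ℂ) U.conjStarAlgEquiv _ R
    (continuousOn_rpow_spectrum R hs) ?_ hR ?_).symm
  · exact (U.toContinuousLinearEquiv.conjContinuousAlgEquiv).continuous
  · exact hR.map _

end Translation

/-! ### Translation invariance of fractional powers -/

section SobolevTranslation

variable {E : Type*} [NormedAddCommGroup E] [NormedSpace ℝ E]
  {G : Type*} [TopologicalSpace G] [ChartedSpace E G] [Group G] [MeasurableSpace G]
  {l : ℕ} {X : Fin l → GroupLieAlgebra 𝓘(ℝ, E) G} {χ : G → ℝ} {μ : Measure G} {y : G} {c τ s : ℝ}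

lemma IsFracPower.const_smul {p : ℝ≥0∞} {f g : G → ℂ} (h : IsFracPower X χ μ τ s p f g) (k : ℂ) :
    IsFracPower X χ μ τ s p (fun x => k * f x) (fun x => k * g x) := by
  obtain ⟨hf, hg, R, hR, v, h1, h2⟩ := h
  have key : ∀ (u : ℕ → Lp ℂ 2 μ) (w : G → ℂ) (T : Lp ℂ 2 μ →L[ℂ] Lp ℂ 2 μ),
      Tendsto (fun n => eLpNorm (fun x => T (u n) x - w x) p μ) atTop (𝓝 0) →
      Tendsto (fun n => eLpNorm (fun x => T (k • u n) x - k * w x) p μ) atTop (𝓝 0) := by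
    intro u w T ht
    have h3 : ∀ n, eLpNorm (fun x => T (k • u n) x - k * w x) p μ =
        ‖k‖ₑ * eLpNorm (fun x => T (u n) x - w x) p μ := by
      intro n
      rw [← eLpNorm_const_smul]
      refine eLpNorm_congr_ae ?_
      rw [map_smul]
      filter_upwards [Lp.coeFn_smul k (T (u n))] with x hx
      simp only [hx, Pi.smul_apply, smul_eq_mul, mul_sub]
    simp_rw [h3]
    simpa using ENNReal.Tendsto.const_mul ht (Or.inr (enorm_ne_top (x := k)))
  exact ⟨hf.const_mul k, hg.const_mul k, R, hR, fun n => k • v n,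
    key v g (ContinuousLinearMap.id ℂ _) h1, key v f (opPow R s) h2⟩

variable [BorelSpace G] [IsTopologicalGroup G]

lemma coeFn_smul_translateEquiv (hc : 0 < c) (h : μ.map (y * ·) = ENNReal.ofReal c • μ)
    (u : Lp ℂ 2 μ) : ((√c : ℝ) : ℂ) • translateEquiv hc h u =ᵐ[μ] fun x => u (y * x) := by
  have hs : 0 < √c := Real.sqrt_pos.2 hc
  filter_upwards [coeFn_translateIsometry hc h u,
    Lp.coeFn_smul ((√c : ℝ) : ℂ) (translateIsometry hc h u)] with x h1 h2
  refine h2.trans ?_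
  rw [Pi.smul_apply, h1, smul_eq_mul, ← mul_assoc, ← Complex.ofReal_mul, mul_inv_cancel₀ hs.ne',
    Complex.ofReal_one, one_mul]

lemma coeFn_translateEquiv_symm (hc : 0 < c) (h : μ.map (y * ·) = ENNReal.ofReal c • μ)
    (u : Lp ℂ 2 μ) :
    (((√c)⁻¹ : ℝ) : ℂ) • (translateEquiv hc h).symm u =ᵐ[μ] fun x => u (y⁻¹ * x) := by
  have h0 : u = translateIsometry hc h ((translateEquiv hc h).symm u) :=
    ((translateEquiv hc h).apply_symm_apply u).symm
  filter_upwards [(quasiMeasurePreserving_mul_left_of_map (map_inv_mul_of_map_mul hc h)).ae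
      (coeFn_translateIsometry hc h ((translateEquiv hc h).symm u)),
    Lp.coeFn_smul (((√c)⁻¹ : ℝ) : ℂ) ((translateEquiv hc h).symm u)] with x h1 h2
  rw [h2, Pi.smul_apply, smul_eq_mul]
  rw [← h0, mul_inv_cancel_left] at h1
  exact h1.symm

variable [LieGroup 𝓘(ℝ, E) ∞ G]

omit [MeasurableSpace G] [BorelSpace G] [IsTopologicalGroup G] in
lemma driftLaplacian_comp_mul_left (X : Fin l → GroupLieAlgebra 𝓘(ℝ, E) G) (χ : G → ℝ) {φ : G → ℂ}
    (hφ : ContMDiff 𝓘(ℝ, E) 𝓘(ℝ, ℂ) ∞ φ) (y x : G) :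
    driftLaplacian X χ (fun x => φ (y * x)) x = driftLaplacian X χ φ (y * x) := by
  simp only [driftLaplacian, lieDeriv_comp_mul_left _ hφ,
    lieDeriv_comp_mul_left _ (contMDiff_lieDeriv _ hφ)]

/-- As `Δ_χ` is left-invariant, a left translate of a resolvent is again a resolvent. -/
lemma IsResolvent.translate {R : Lp ℂ 2 μ →L[ℂ] Lp ℂ 2 μ} (hR : IsResolvent X χ μ τ R)
    (hc : 0 < c) (h : μ.map (y * ·) = ENNReal.ofReal c • μ) :
    IsResolvent X χ μ τ ((translateEquiv hc h).conjStarAlgEquiv R) := by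
  refine ⟨hR.selfAdjoint.map _, fun φ hφ hcs u w hu hw => ?_⟩
  have hqm := quasiMeasurePreserving_mul_left_of_map (map_inv_mul_of_map_mul hc h)
  have h1 := hR.leftInverse (fun x => φ (y⁻¹ * x)) (hφ.comp contMDiff_mul_left)
    (hcs.comp_homeomorph (Homeomorph.mulLeft y⁻¹))
    ((((√c)⁻¹ : ℝ) : ℂ) • (translateEquiv hc h).symm u)
    ((((√c)⁻¹ : ℝ) : ℂ) • (translateEquiv hc h).symm w)
    ((coeFn_translateEquiv_symm hc h u).trans (hqm.ae_eq_comp hu))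
    ((coeFn_translateEquiv_symm hc h w).trans ((hqm.ae_eq_comp hw).trans
      (Eventually.of_forall fun x => ?_)))
  · have hs : ((((√c)⁻¹ : ℝ) : ℂ)) ≠ 0 := by
      exact_mod_cast (inv_pos.2 (Real.sqrt_pos.2 hc)).ne'
    rw [map_smul] at h1
    have h2 := smul_right_injective _ hs h1
    rw [LinearIsometryEquiv.conjStarAlgEquiv_apply_apply, h2]
    exact (translateEquiv hc h).apply_symm_apply u
  · simp only [Function.comp_apply, driftLaplacian_comp_mul_left X χ hφ]

/-- As `Δ_χ` is left-invariant, its fractional powers commute with left translations. -/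
lemma IsFracPower.translate (hs : 0 < s) {p : ℝ≥0∞} (hp : p ≠ ⊤) {f g : G → ℂ}
    (hfg : IsFracPower X χ μ τ s p f g) (hc : 0 < c)
    (h : μ.map (y * ·) = ENNReal.ofReal c • μ) :
    IsFracPower X χ μ τ s p (fun x => f (y * x)) (fun x => g (y * x)) := by
  obtain ⟨hf, hg, R, hR, v, h1, h2⟩ := hfg
  have key : ∀ (u : ℕ → Lp ℂ 2 μ) (u' : ℕ → Lp ℂ 2 μ) (w : G → ℂ), AEStronglyMeasurable w μ →
      (∀ n, u' n =ᵐ[μ] fun x => u n (y * x)) →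
      Tendsto (fun n => eLpNorm (fun x => u n x - w x) p μ) atTop (𝓝 0) →
      Tendsto (fun n => eLpNorm (fun x => u' n x - w (y * x)) p μ) atTop (𝓝 0) := by
    intro u u' w hw hu' ht
    have h3 : ∀ n, eLpNorm (fun x => u' n x - w (y * x)) p μ =
        ENNReal.ofReal c ^ (1 / p.toReal) * eLpNorm (fun x => u n x - w x) p μ := by
      intro n
      refine Eq.trans (eLpNorm_congr_ae ?_)
        (eLpNorm_comp_mul_left h hp ((Lp.aestronglyMeasurable (u n)).sub hw))
      filter_upwards [hu' n] with x hx
      rw [hx]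
    simp_rw [h3]
    simpa using ENNReal.Tendsto.const_mul ht (Or.inr (ENNReal.rpow_lt_top_of_nonneg
      (by positivity) ENNReal.ofReal_ne_top).ne)
  refine ⟨memLp_comp_mul_left h hp hf, memLp_comp_mul_left h hp hg, _, hR.translate hc h,
    fun n => ((√c : ℝ) : ℂ) • translateEquiv hc h (v n),
    key v _ g hg.1 (fun n => coeFn_smul_translateEquiv hc h (v n)) h1,
    key (fun n => opPow R s (v n)) _ f hf.1 (fun n => ?_) h2⟩
  rw [opPow_conj _ hR.selfAdjoint hs, map_smul, LinearIsometryEquiv.conjStarAlgEquiv_apply_apply,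
    LinearIsometryEquiv.symm_apply_apply]
  exact coeFn_smul_translateEquiv hc h _

end SobolevTranslation

/-! ### Blow-up of the Moser–Trudinger functional -/

section Exponential

lemma pow_div_factorial_le_exp_sub_sum {t : ℝ} (ht : 0 ≤ t) (N : ℕ) :
    t ^ (N + 1) / (N + 1).factorial ≤
      Real.exp t - ∑ k ∈ Finset.range N, t ^ k / k.factorial := by
  have h := Real.sum_le_exp_of_nonneg ht (N + 2)
  rw [Finset.sum_range_succ, Finset.sum_range_succ] at h
  have : 0 ≤ t ^ N / N.factorial := by positivity
  linarith

/-- The integrand of the Moser–Trudinger inequality dominates a power of exponent larger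
than `p`. -/
lemma le_moserTrudinger_integrand {p γ r : ℝ} (hγ : 0 < γ) (hr : 0 ≤ r) (N : ℕ) :
    γ ^ (N + 1) / (N + 1).factorial * r ^ (p / (p - 1) * ((N + 1 : ℕ) : ℝ)) ≤
      Real.exp (γ * r ^ (p / (p - 1))) -
        ∑ k ∈ Finset.range N, γ ^ k / (k.factorial : ℝ) * r ^ (p / (p - 1) * (k : ℝ)) := by
  have h1 : ∀ k : ℕ, γ ^ k / (k.factorial : ℝ) * r ^ (p / (p - 1) * (k : ℝ)) =
      (γ * r ^ (p / (p - 1))) ^ k / k.factorial := by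
    intro k
    rw [Real.rpow_mul hr, Real.rpow_natCast, mul_pow]; ring
  simp_rw [h1]
  exact pow_div_factorial_le_exp_sub_sum (by positivity) N

end Exponential

section Blowup

variable {E : Type*} [NormedAddCommGroup E] [NormedSpace ℝ E]
  {G : Type*} [TopologicalSpace G] [ChartedSpace E G] [Group G] [MeasurableSpace G]
  [BorelSpace G] [IsTopologicalGroup G] [LieGroup 𝓘(ℝ, E) ∞ G]
  {l : ℕ} {X : Fin l → GroupLieAlgebra 𝓘(ℝ, E) G} {χ : G → ℝ} {μ : Measure G}

/-- The Moser–Trudinger inequality applied to the normalised translate `m ^ (-1/p) f (z x)`, where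
translation by `z` multiplies `μ` by `m`: the left-hand side gains a negative power of `m`. -/
lemma GlobalMoserTrudinger.rpow_mul_lintegral_le {τ α p γ C m : ℝ}
    (hMT : GlobalMoserTrudinger X χ μ τ α p γ C) (hα : 0 < α) (hp : 1 < p) (hγ : 0 < γ)
    {z : G} (hm : 0 < m) (hz : μ.map (z * ·) = ENNReal.ofReal m • μ) {f g : G → ℂ}
    (hfg : IsFracPower X χ μ τ (α / 2) (ENNReal.ofReal p) f g) (hf : Measurable f)
    (hg : eLpNorm g (ENNReal.ofReal p) μ ≤ 1) (N : ℕ) (hN : N = ⌈p - 1⌉₊) :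
    ENNReal.ofReal (γ ^ (N + 1) / (N + 1).factorial *
        m ^ (1 - 1 / (p - 1) * ((N + 1 : ℕ) : ℝ))) *
        ∫⁻ x, ENNReal.ofReal (‖f x‖ ^ (p / (p - 1) * ((N + 1 : ℕ) : ℝ))) ∂μ ≤
      ENNReal.ofReal C * eLpNorm f (ENNReal.ofReal p) μ ^ p := by
  have hp0 : 0 < p := one_pos.trans hp
  have hp1 : 0 < p - 1 := sub_pos.2 hp
  set K : ℝ := m ^ (-(1 / p)) with hK
  have hK0 : 0 < K := Real.rpow_pos_of_pos hm _
  have hnorm : ∀ u : G → ℂ, AEStronglyMeasurable u μ →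
      eLpNorm (fun x => (K : ℂ) * u (z * x)) (ENNReal.ofReal p) μ =
        eLpNorm u (ENNReal.ofReal p) μ := by
    intro u hu
    have h1 : (fun x => (K : ℂ) * u (z * x)) = (K : ℂ) • fun x => u (z * x) := rfl
    rw [h1, eLpNorm_const_smul, eLpNorm_comp_mul_left hz ENNReal.ofReal_ne_top hu,
      ENNReal.toReal_ofReal hp0.le, ← mul_assoc, ENNReal.ofReal_rpow_of_pos hm,
      ← ofReal_norm, Complex.norm_real, Real.norm_of_nonneg hK0.le,
      ← ENNReal.ofReal_mul hK0.le, hK, ← Real.rpow_add hm]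
    simp
  have hS : sobolevNorm X χ μ τ α p (fun x => (K : ℂ) * f (z * x)) ≤ 1 :=
    (iInf₂_le _ ((hfg.translate (half_pos hα) ENNReal.ofReal_ne_top hm hz).const_smul
      (K : ℂ))).trans ((hnorm g hfg.2.1.1).trans_le hg)
  refine le_trans ?_ ((hMT _ hS).trans_eq (by rw [hnorm f hfg.1.1]))
  set q : ℝ := p / (p - 1) * ((N + 1 : ℕ) : ℝ) with hq
  have hmeas : Measurable fun x => ENNReal.ofReal (‖f x‖ ^ q) := by fun_prop
  have hI : ∫⁻ x, ENNReal.ofReal (‖f (z * x)‖ ^ q) ∂μ =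
      ENNReal.ofReal m * ∫⁻ x, ENNReal.ofReal (‖f x‖ ^ q) ∂μ := by
    rw [← lintegral_map (μ := μ) hmeas (measurable_const_mul z), hz, lintegral_smul_measure,
      smul_eq_mul]
  -- `K ^ q * m = m ^ (1 - q / p)`
  have hexp : γ ^ (N + 1) / (N + 1).factorial *
      m ^ (1 - 1 / (p - 1) * ((N + 1 : ℕ) : ℝ)) =
      (γ ^ (N + 1) / (N + 1).factorial * K ^ q) * m := by
    rw [mul_assoc, hK, ← Real.rpow_mul hm.le]
    congr 1
    nth_rw 3 [← Real.rpow_one m]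
    rw [← Real.rpow_add hm]
    congr 1
    rw [hq]
    field_simp
    ring
  rw [hexp, ENNReal.ofReal_mul (by positivity), mul_assoc, ← hI,
    ← lintegral_const_mul _ (by fun_prop)]
  refine lintegral_mono fun x => ?_
  rw [← ENNReal.ofReal_mul (by positivity)]
  refine ENNReal.ofReal_le_ofReal ?_
  have h2 := le_moserTrudinger_integrand (p := p) hγ (norm_nonneg ((K : ℂ) * f (z * x))) N
  rw [hN] at h2 ⊢
  refine le_trans (le_of_eq ?_) h2
  rw [norm_mul, Complex.norm_real, Real.norm_of_nonneg hK0.le,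
    Real.mul_rpow hK0.le (norm_nonneg _), hq, hN, mul_assoc]

/-- No Moser–Trudinger inequality holds when translations contract `μ` by arbitrarily small
factors. -/
lemma GlobalMoserTrudinger.false_of_contracting {τ α p γ C t : ℝ}
    (hMT : GlobalMoserTrudinger X χ μ τ α p γ C) (hα : 0 < α) (hp : 1 < p) (hγ : 0 < γ)
    (ht : 0 < t) (ht1 : t < 1)
    (hz : ∀ k : ℕ, ∃ z : G, μ.map (z * ·) = ENNReal.ofReal (t ^ k) • μ) {f g : G → ℂ}
    (hfg : IsFracPower X χ μ τ (α / 2) (ENNReal.ofReal p) f g) (hf : Measurable f)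
    (hf0 : ¬ f =ᵐ[μ] 0) : False := by
  have hp1 : 0 < p - 1 := sub_pos.2 hp
  -- normalise the Sobolev norm of `f`
  obtain ⟨a, ha, hag⟩ : ∃ a : ℝ, 0 < a ∧
      ENNReal.ofReal a * eLpNorm g (ENNReal.ofReal p) μ ≤ 1 := by
    have hfin : eLpNorm g (ENNReal.ofReal p) μ ≠ ⊤ := hfg.2.1.2.ne
    refine ⟨((eLpNorm g (ENNReal.ofReal p) μ).toReal + 1)⁻¹, by positivity, ?_⟩
    rw [← ENNReal.ofReal_toReal hfin, ← ENNReal.ofReal_mul (by positivity),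
      ENNReal.toReal_ofReal ENNReal.toReal_nonneg, ENNReal.ofReal_le_one,
      inv_mul_le_one₀ (by positivity)]
    linarith
  have hfg' := hfg.const_smul (a : ℂ)
  have hg' : eLpNorm (fun x => (a : ℂ) * g x) (ENNReal.ofReal p) μ ≤ 1 := by
    have h1 : (fun x => (a : ℂ) * g x) = (a : ℂ) • g := rfl
    rwa [h1, eLpNorm_const_smul, ← ofReal_norm, Complex.norm_real,
      Real.norm_of_nonneg ha.le]
  have hf' : Measurable fun x => (a : ℂ) * f x := hf.const_mul _
  set N : ℕ := ⌈p - 1⌉₊ with hN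
  set I := ∫⁻ x, ENNReal.ofReal (‖(a : ℂ) * f x‖ ^ (p / (p - 1) * ((N + 1 : ℕ) : ℝ))) ∂μ with hI
  have hI0 : I ≠ 0 := by
    rw [hI, Ne, lintegral_eq_zero_iff (by fun_prop)]
    refine fun h => hf0 ?_
    filter_upwards [h] with x hx
    by_contra hne
    have h3 : 0 < ‖(a : ℂ) * f x‖ :=
      norm_pos_iff.2 (mul_ne_zero (by exact_mod_cast ha.ne') hne)
    exact (ENNReal.ofReal_pos.2 (Real.rpow_pos_of_pos h3 _)).ne' hx
  set Q := ENNReal.ofReal C *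
    eLpNorm (fun x => (a : ℂ) * f x) (ENNReal.ofReal p) μ ^ p with hQ
  have hQtop : Q ≠ ⊤ := ENNReal.mul_ne_top ENNReal.ofReal_ne_top
    (ENNReal.rpow_ne_top_of_nonneg (by linarith) hfg'.1.2.ne)
  set c₀ : ℝ := γ ^ (N + 1) / (N + 1).factorial with hc₀
  have hc₀pos : 0 < c₀ := by positivity
  set e : ℝ := 1 - 1 / (p - 1) * ((N + 1 : ℕ) : ℝ) with he
  have he0 : e < 0 := by
    have h4 : p - 1 < ((N + 1 : ℕ) : ℝ) := by
      have := Nat.le_ceil (p - 1)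
      push_cast
      linarith
    rw [he, sub_neg, one_div_mul_eq_div, one_lt_div hp1]
    exact h4
  have hbound : ∀ k : ℕ, ENNReal.ofReal (c₀ * (t ^ e) ^ k) ≤ Q / I := by
    intro k
    obtain ⟨z, hz⟩ := hz k
    have h5 := hMT.rpow_mul_lintegral_le hα hp hγ (pow_pos ht k) hz hfg' hf' hg' N hN
    rw [ENNReal.le_div_iff_mul_le (Or.inl hI0) (Or.inr hQtop)]
    rwa [← Real.rpow_natCast t k, ← Real.rpow_mul ht.le, mul_comm (k : ℝ), Real.rpow_mul ht.le,
      Real.rpow_natCast] at h5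
  have hlim : Tendsto (fun k : ℕ => ENNReal.ofReal (c₀ * (t ^ e) ^ k)) atTop (𝓝 ⊤) :=
    ENNReal.tendsto_ofReal_atTop.comp ((tendsto_pow_atTop_atTop_of_one_lt
      (Real.one_lt_rpow_of_pos_of_lt_one_of_neg ht ht1 he0)).const_mul_atTop hc₀pos)
  exact (ENNReal.div_lt_top hQtop hI0).ne (top_le_iff.1 (le_of_tendsto' hlim hbound))

end Blowup

end SubLaplacian

end

theorem mainTheorem8
    {E : Type*} [NormedAddCommGroup E] [NormedSpace ℝ E] [FiniteDimensional ℝ E]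
    {G : Type*} [TopologicalSpace G] [ChartedSpace E G] [Group G]
    [LieGroup 𝓘(ℝ, E) ∞ G] [IsTopologicalGroup G] [LocallyCompactSpace G]
    [T2Space G] [SecondCountableTopology G] [ConnectedSpace G] [NoncompactSpace G]
    [MeasurableSpace G] [BorelSpace G]
    (lam : Measure G) [lam.IsHaarMeasure]
    {l : ℕ} (X : Fin l → GroupLieAlgebra 𝓘(ℝ, E) G)
    (hXlin : LinearIndependent ℝ X) (hX : SubLaplacian.IsHormander X)
    (d : ℕ) (hd : 0 < d) (D : ℝ) (hD : 0 < D)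
    (hgrowth : SubLaplacian.HasVolumeGrowth X lam d D)
    (b : ℝ) (hb : 0 < b)
    (χ : G →* ℝ) (hχ : Continuous χ) (hχpos : ∀ x, 0 < χ x)
    (p : ℝ) (hp : 1 < p) (γ : ℝ) (hγ : 0 < γ) (C : ℝ) (hC : 0 < C)
    (hMT : SubLaplacian.GlobalMoserTrudinger X χ (SubLaplacian.muChi lam χ)
      (SubLaplacian.shift X χ b D) (d / p) p γ C) :
    SubLaplacian.muChi lam χ = lam := by
  by_cases hone : ∀ x, SubLaplacian.leftDensity χ x = 1
  · rw [SubLaplacian.muChi_eq_withDensity lam hχ]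
    simp [hone]
  exfalso
  push Not at hone
  obtain ⟨y, hy⟩ := hone
  have hψ := SubLaplacian.leftDensity_pos hχpos
  -- one of `y`, `y⁻¹` contracts the measure
  obtain ⟨y, hy⟩ : ∃ y, SubLaplacian.leftDensity χ y < 1 := by
    rcases hy.lt_or_gt with h | h
    · exact ⟨y, h⟩
    · refine ⟨y⁻¹, ?_⟩
      rw [← mul_lt_mul_iff_right₀ (hψ y), ← map_mul, mul_inv_cancel, map_one, mul_one]
      exact h
  obtain ⟨f, g, hfg, hfm, hf0⟩ := SubLaplacian.exists_isFracPower_ne_zero lam hχ hχpos X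
    (le_max_right _ _ : 1 ≤ SubLaplacian.shift X χ b D)
    (by positivity : 0 < (d : ℝ) / p / 2) hp.le
  refine hMT.false_of_contracting (by positivity) hp hγ (hψ y) hy (fun k => ⟨(y ^ k)⁻¹, ?_⟩)
    hfg hfm hf0
  rw [SubLaplacian.map_mul_left_muChi lam hχ hχpos,
    inv_eq_of_mul_eq_one_right (by rw [← map_mul, inv_mul_cancel, map_one]), map_pow]
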